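/- Let $(M,g)$ be a compact $n$-dimensional smooth pseudo-Riemannian manifold (without boundary), with Levi-Civita connection $\nabla^g$, scalar curvature $\mathrm{scal}$ and volume measure $d\mu_g$, and let $f$ be a smooth function on $M$ such that $c:=|\mathrm{grad} f|^2:=g(\mathrm{grad} f,\mathrm{grad} f)$ is constant; write $|\mathrm{grad} f|^4=c^2$. Let $\mathrm{Hess}(f)(X,Y)=g(\nabla^g_X\,\mathrm{grad} f,Y)$, with square norm $|\mathrm{Hess}(f)|^2=g^{ik}g^{jl}\mathrm{Hess}(f)_{ij}\mathrm{Hess}(f)_{kl}$. Let $\nabla^{df}$ be the connection $$\nabla^{df}_XY=\nabla^g_XY+df(X)Y+df(Y)X+g(X,Y)\,\mathrm{grad} f .$$ For $\nabla\in\{\nabla^g,\nabla^{df}\}$ let $\mathrm{Ric}^{\nabla}(Y,Z)=\mathrm{tr}(X\mapsto R^{\nabla}(X,Y)Z)$, with $R^\nabla(X,Y)=\nabla_X\nabla_Y-\nabla_Y\nabla_X-\nabla_{[X,Y]}$, and let the Ricci operators $Q^g$, $Q^{df}$ be defined by $g(QX,Y)=\mathrm{Ric}^\nabla(X,Y)$.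 For an affine connection $\nabla$, a $(1,1)$-tensor field $J$ and a smooth function $\lambda$, the data $(\nabla,J,\mathrm{grad} f,\lambda)$ are a gradient almost soliton if $\nabla\,\mathrm{grad} f+J=\lambda I$, and a gradient soliton if moreover $\lambda$ is constant. (i) If $(\nabla^g,Q^{df},\mathrm{grad} f,\lambda)$ is a gradient almost soliton, then $$2(n-1)|\mathrm{grad} f|^4\,\mathrm{vol}(M)=\int_M|\mathrm{Hess}(f)|^2d\mu_g+|\mathrm{grad} f|^2\int_M\lambda\,d\mu_g+n\int_M\mathrm{grad} f(\lambda)\,d\mu_g-\int_M\mathrm{grad} f(\mathrm{scal})\,d\mu_g ;$$ in particular, whenever $n\ge 2$ and $|\mathrm{grad} f|^2\ne0$, $\mathrm{vol}(M)$ equals $\frac{1}{2(n-1)|\mathrm{grad} f|^4}$ times the right-hand side. (ii) If $(\nabla^{df},Q^g,\mathrm{grad} f,\lambda)$ is a gradient soliton, then $$(\lambda-3|\mathrm{grad} f|^2)\,|\mathrm{grad} f|^2\,\mathrm{vol}(M)=-\int_M|\mathrm{Hess}(f)|^2d\mu_g+\int_M\mathrm{grad} f(\mathrm{scal})\,d\mu_g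 ;$$ in particular, whenever $|\mathrm{grad} f|^2\ne0$ and $\lambda\neq 3|\mathrm{grad} f|^2$, $\mathrm{vol}(M)$ equals $\frac{1}{(\lambda-3|\mathrm{grad} f|^2)|\mathrm{grad} f|^2}$ times the right-hand side. -/

import Mathlib

open Bundle Set MeasureTheory VectorField
open scoped Manifold ContDiff Topology

noncomputable section

/-- A smooth pseudo-Riemannian metric on an `n`-dimensional smooth manifold `M` (without boundary):
a smooth field of nondegenerate symmetric bilinear forms on the tangent spaces. -/
structure PseudoRiemannianMetric (n : ℕ) (M : Type*) [TopologicalSpace M]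
    [ChartedSpace (EuclideanSpace ℝ (Fin n)) M] [IsManifold (𝓡 n) ∞ M] where
  inner (x : M) : TangentSpace (𝓡 n) x →L[ℝ] TangentSpace (𝓡 n) x →L[ℝ] ℝ
  symm (x : M) (v w : TangentSpace (𝓡 n) x) : inner x v w = inner x w v
  nondegenerate (x : M) (v : TangentSpace (𝓡 n) x) (hv : ∀ w, inner x v w = 0) : v = 0
  contMDiff : ContMDiff (𝓡 n)
    ((𝓡 n).prod 𝓘(ℝ, EuclideanSpace ℝ (Fin n) →L[ℝ] EuclideanSpace ℝ (Fin n) →L[ℝ] ℝ)) ∞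
    (fun x ↦ TotalSpace.mk' (EuclideanSpace ℝ (Fin n) →L[ℝ] EuclideanSpace ℝ (Fin n) →L[ℝ] ℝ)
      (E := fun x ↦ TangentSpace (𝓡 n) x →L[ℝ] TangentSpace (𝓡 n) x →L[ℝ] ℝ) x (inner x))

namespace PseudoRiemannianMetric

variable {n : ℕ} {M : Type*} [TopologicalSpace M]
  [ChartedSpace (EuclideanSpace ℝ (Fin n)) M] [IsManifold (𝓡 n) ∞ M]

instance instFiniteDimensionalTangentSpace (x : M) :
    FiniteDimensional ℝ (TangentSpace (𝓡 n) x) :=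
  inferInstanceAs (FiniteDimensional ℝ (EuclideanSpace ℝ (Fin n)))

instance instT2SpaceTangentSpace (x : M) : T2Space (TangentSpace (𝓡 n) x) :=
  inferInstanceAs (T2Space (EuclideanSpace ℝ (Fin n)))

/-- Differentiability of a vector field at a point. -/
abbrev VDiffAt (V : Π x : M, TangentSpace (𝓡 n) x) (x : M) : Prop :=
  MDifferentiableAt (𝓡 n) ((𝓡 n).prod 𝓘(ℝ, EuclideanSpace ℝ (Fin n)))
    (fun y ↦ TotalSpace.mk' (EuclideanSpace ℝ (Fin n)) y (V y)) x

variable (g : PseudoRiemannianMetric n M)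

/-- The metric at a point, as a bilinear form. -/
def bilin (x : M) : LinearMap.BilinForm ℝ (TangentSpace (𝓡 n) x) :=
  LinearMap.mk₂ ℝ (fun v w ↦ g.inner x v w) (by simp) (by simp) (by simp) (by simp)

theorem bilin_nondegenerate (x : M) : (g.bilin x).Nondegenerate :=
  ⟨fun v hv ↦ g.nondegenerate x v hv,
    fun v hv ↦ g.nondegenerate x v fun w ↦ (g.symm x v w).trans (hv w)⟩

/-- The musical isomorphism from covectors to vectors. -/
def sharp (x : M) : (TangentSpace (𝓡 n) x →L[ℝ] ℝ) →ₗ[ℝ] TangentSpace (𝓡 n) x :=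
  ((g.bilin x).toDual (g.bilin_nondegenerate x)).symm.toLinearMap ∘ₗ
    ContinuousLinearMap.coeLM ℝ

theorem inner_sharp (x : M) (φ : TangentSpace (𝓡 n) x →L[ℝ] ℝ) (v : TangentSpace (𝓡 n) x) :
    g.inner x (g.sharp x φ) v = φ v :=
  LinearMap.BilinForm.apply_toDual_symm_apply (hB := g.bilin_nondegenerate x)
    (φ : Module.Dual ℝ (TangentSpace (𝓡 n) x)) v

theorem ext_inner (x : M) {v w : TangentSpace (𝓡 n) x} (h : ∀ u, g.inner x v u = g.inner x w u) :
    v = w := by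
  rw [← sub_eq_zero]
  exact g.nondegenerate x _ fun u ↦ by simp [h u]

theorem mdifferentiableAt_inner {x : M} {V W : Π x : M, TangentSpace (𝓡 n) x}
    (hV : VDiffAt V x) (hW : VDiffAt W x) :
    MDifferentiableAt (𝓡 n) 𝓘(ℝ, ℝ) (fun y ↦ g.inner y (V y) (W y)) x := by
  have h := MDifferentiableAt.clm_bundle_apply₂ (F₁ := EuclideanSpace ℝ (Fin n))
    (F₂ := EuclideanSpace ℝ (Fin n)) (F₃ := ℝ) (E₁ := fun y : M ↦ TangentSpace (𝓡 n) y)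
    (E₂ := fun y : M ↦ TangentSpace (𝓡 n) y) (E₃ := Bundle.Trivial M ℝ) (b := fun y : M ↦ y) (IM := 𝓡 n)
    (ψ := g.inner) (g.contMDiff.mdifferentiableAt (by simp)) hV hW
  rw [mdifferentiableAt_totalSpace] at h
  exact h.2

/-- Half of the right-hand side of Koszul's formula for `2 g(∇_V σ, W)`. -/
def koszul (σ V W : Π x : M, TangentSpace (𝓡 n) x) (x : M) : ℝ :=
  (1 / 2 : ℝ) * (mvfderiv (𝓡 n) (fun y ↦ g.inner y (σ y) (W y)) x (V x)
    + mvfderiv (𝓡 n) (fun y ↦ g.inner y (W y) (V y)) x (σ x)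
    - mvfderiv (𝓡 n) (fun y ↦ g.inner y (V y) (σ y)) x (W x)
    + g.inner x (mlieBracket (𝓡 n) V σ x) (W x)
    - g.inner x (mlieBracket (𝓡 n) σ W x) (V x)
    + g.inner x (mlieBracket (𝓡 n) W V x) (σ x))

theorem tensorial_koszul_left {x : M} {σ W : Π x : M, TangentSpace (𝓡 n) x}
    (hσ : VDiffAt σ x) (hW : VDiffAt W x) :
    TensorialAt (𝓡 n) (EuclideanSpace ℝ (Fin n)) (fun V ↦ g.koszul σ V W x) x where
  smul {f V} hf hV := by
    have h1 := g.mdifferentiableAt_inner hW hV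
    have h2 := g.mdifferentiableAt_inner hV hσ
    simp [koszul, mvfderiv_fun_mul hf h1, mvfderiv_fun_mul hf h2,
      mlieBracket_smul_left hf hV, mlieBracket_smul_right hf hV]
    rw [g.symm x (W x) (V x)]
    ring
  add {V V'} hV hV' := by
    simp [koszul, mvfderiv_fun_add (g.mdifferentiableAt_inner hW hV) (g.mdifferentiableAt_inner hW hV'),
      mvfderiv_fun_add (g.mdifferentiableAt_inner hV hσ) (g.mdifferentiableAt_inner hV' hσ),
      mlieBracket_add_left hV hV', mlieBracket_add_right hV hV']
    ring

theorem tensorial_koszul_right {x : M} {σ V : Π x : M, TangentSpace (𝓡 n) x}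
    (hσ : VDiffAt σ x) (hV : VDiffAt V x) :
    TensorialAt (𝓡 n) (EuclideanSpace ℝ (Fin n)) (fun W ↦ g.koszul σ V W x) x where
  smul {f W} hf hW := by
    simp [koszul, mvfderiv_fun_mul hf (g.mdifferentiableAt_inner hσ hW),
      mvfderiv_fun_mul hf (g.mdifferentiableAt_inner hW hV),
      mlieBracket_smul_left hf hW, mlieBracket_smul_right hf hW]
    rw [g.symm x (W x) (V x), g.symm x (W x) (σ x)]
    ring
  add {W W'} hW hW' := by
    simp [koszul, mvfderiv_fun_add (g.mdifferentiableAt_inner hσ hW) (g.mdifferentiableAt_inner hσ hW'),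
      mvfderiv_fun_add (g.mdifferentiableAt_inner hW hV) (g.mdifferentiableAt_inner hW' hV),
      mlieBracket_add_left hW hW', mlieBracket_add_right hW hW']
    ring

theorem koszul_add {x : M} {σ σ' V W : Π x : M, TangentSpace (𝓡 n) x}
    (hσ : VDiffAt σ x) (hσ' : VDiffAt σ' x)
    (hV : VDiffAt V x) (hW : VDiffAt W x) :
    g.koszul (σ + σ') V W x = g.koszul σ V W x + g.koszul σ' V W x := by
  simp [koszul, mvfderiv_fun_add (g.mdifferentiableAt_inner hσ hW) (g.mdifferentiableAt_inner hσ' hW),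
      mvfderiv_fun_add (g.mdifferentiableAt_inner hV hσ) (g.mdifferentiableAt_inner hV hσ'),
      mlieBracket_add_left hσ hσ', mlieBracket_add_right hσ hσ']
  ring

theorem koszul_smul {x : M} {f : M → ℝ} {σ V W : Π x : M, TangentSpace (𝓡 n) x}
    (hσ : VDiffAt σ x) (hf : MDifferentiableAt (𝓡 n) 𝓘(ℝ, ℝ) f x)
    (hV : VDiffAt V x) (hW : VDiffAt W x) :
    g.koszul (f • σ) V W x =
      f x * g.koszul σ V W x + mvfderiv (𝓡 n) f x (V x) * g.inner x (σ x) (W x) := by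
  simp [koszul, mvfderiv_fun_mul hf (g.mdifferentiableAt_inner hσ hW),
      mvfderiv_fun_mul hf (g.mdifferentiableAt_inner hV hσ),
      mlieBracket_smul_left hf hσ, mlieBracket_smul_right hf hσ]
  rw [g.symm x (V x) (σ x)]
  ring

open scoped Classical in
/-- The Levi-Civita connection as an operation on vector fields: `∇_v σ` at `x` is the tangent
vector determined by Koszul's formula (with junk value `0` where `σ` is not differentiable). -/
def leviCivitaFun (σ : Π x : M, TangentSpace (𝓡 n) x) (x : M) :
    TangentSpace (𝓡 n) x →L[ℝ] TangentSpace (𝓡 n) x :=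
  if hσ : VDiffAt σ x then
    LinearMap.toContinuousLinearMap (g.sharp x ∘ₗ
      (TensorialAt.mkHom₂ (fun V W ↦ g.koszul σ V W x) x
        (fun _ hW ↦ g.tensorial_koszul_left hσ hW)
        (fun _ hV ↦ g.tensorial_koszul_right hσ hV)).toLinearMap)
  else 0

theorem inner_leviCivitaFun {x : M} {σ V W : Π x : M, TangentSpace (𝓡 n) x}
    (hσ : VDiffAt σ x) (hV : VDiffAt V x) (hW : VDiffAt W x) :
    g.inner x (g.leviCivitaFun σ x (V x)) (W x) = g.koszul σ V W x := by
  rw [leviCivitaFun, dif_pos hσ]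
  refine (g.inner_sharp x _ _).trans ?_
  exact TensorialAt.mkHom₂_apply _ _ hV hW

theorem inner_leviCivitaFun_extend {x : M} {σ : Π x : M, TangentSpace (𝓡 n) x}
    (hσ : VDiffAt σ x) (v w : TangentSpace (𝓡 n) x) :
    g.inner x (g.leviCivitaFun σ x v) w = g.koszul σ
      (FiberBundle.extend (EuclideanSpace ℝ (Fin n)) v)
      (FiberBundle.extend (EuclideanSpace ℝ (Fin n)) w) x := by
  have := g.inner_leviCivitaFun hσ
    (FiberBundle.mdifferentiableAt_extend (𝓡 n) (EuclideanSpace ℝ (Fin n)) v)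
    (FiberBundle.mdifferentiableAt_extend (𝓡 n) (EuclideanSpace ℝ (Fin n)) w)
  simpa using this

/-- The Levi-Civita connection `∇^g`. -/
def leviCivita : CovariantDerivative (𝓡 n) (EuclideanSpace ℝ (Fin n))
    (TangentSpace (𝓡 n) : M → Type _) where
  toFun := g.leviCivitaFun
  isCovariantDerivativeOnUniv :=
    { add := by
        intro σ σ' x hσ hσ' _
        ext1 v
        refine g.ext_inner x fun w ↦ ?_
        have h := mdifferentiableAt_add_section hσ hσ'
        simp only [add_apply, map_add]
        rw [g.inner_leviCivitaFun_extend h, g.inner_leviCivitaFun_extend hσ,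
          g.inner_leviCivitaFun_extend hσ']
        exact g.koszul_add hσ hσ' (FiberBundle.mdifferentiableAt_extend ..) (FiberBundle.mdifferentiableAt_extend ..)
      leibniz := by
        intro σ f x hσ hf _
        ext1 v
        refine g.ext_inner x fun w ↦ ?_
        have h := hf.smul_section hσ
        simp only [add_apply, map_add, smul_apply, map_smul,
          ContinuousLinearMap.smulRight_apply]
        rw [g.inner_leviCivitaFun_extend h, g.inner_leviCivitaFun_extend hσ]
        refine (g.koszul_smul hσ hf (FiberBundle.mdifferentiableAt_extend ..)
          (FiberBundle.mdifferentiableAt_extend ..)).trans ?_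
        simp }

/-- The Levi-Civita connection is torsion free. -/
theorem torsion_leviCivita : (g.leviCivita).torsion = 0 := by
  rw [CovariantDerivative.torsion_eq_zero_iff]
  intro X Y x hX hY
  refine g.ext_inner x fun w ↦ ?_
  have hw := FiberBundle.mdifferentiableAt_extend (𝓡 n) (EuclideanSpace ℝ (Fin n)) w
  have h1 := g.inner_leviCivitaFun hY hX hw
  have h2 := g.inner_leviCivitaFun hX hY hw
  rw [FiberBundle.extend_apply_self] at h1 h2
  simp only [map_sub, sub_apply]
  change g.inner x (g.leviCivitaFun Y x (X x)) w - g.inner x (g.leviCivitaFun X x (Y x)) w = _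
  rw [h1, h2]
  set W := FiberBundle.extend (EuclideanSpace ℝ (Fin n)) w with hW
  have hWx : W x = w := by simp [hW]
  simp only [koszul, hWx]
  rw [mlieBracket_swap_apply (V := Y) (W := X), mlieBracket_swap_apply (V := X) (W := W),
    mlieBracket_swap_apply (V := Y) (W := W)]
  simp only [fun y ↦ g.symm y (W y) (X y), fun y ↦ g.symm y (W y) (Y y), fun y ↦ g.symm y (Y y) (X y)]
  simp
  ring

/-- The Levi-Civita connection is compatible with the metric. -/
theorem mvfderiv_inner {x : M} {X Y : Π x : M, TangentSpace (𝓡 n) x}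
    (hX : VDiffAt X x) (hY : VDiffAt Y x) (v : TangentSpace (𝓡 n) x) :
    mvfderiv (𝓡 n) (fun y ↦ g.inner y (X y) (Y y)) x v =
      g.inner x (g.leviCivita X x v) (Y x) + g.inner x (X x) (g.leviCivita Y x v) := by
  have hv := FiberBundle.mdifferentiableAt_extend (𝓡 n) (EuclideanSpace ℝ (Fin n)) v
  have h1 := g.inner_leviCivitaFun hX hv hY
  have h2 := g.inner_leviCivitaFun hY hv hX
  rw [FiberBundle.extend_apply_self] at h1 h2
  rw [g.symm x (X x)]
  change _ = g.inner x (g.leviCivitaFun X x v) (Y x) + g.inner x (g.leviCivitaFun Y x v) (X x)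
  rw [h1, h2]
  set V := FiberBundle.extend (EuclideanSpace ℝ (Fin n)) v with hV
  have hVx : V x = v := by simp [hV]
  simp only [koszul, hVx]
  rw [mlieBracket_swap_apply (V := Y) (W := X), mlieBracket_swap_apply (V := X) (W := V),
    mlieBracket_swap_apply (V := Y) (W := V)]
  simp only [fun y ↦ g.symm y (Y y) (V y), fun y ↦ g.symm y (X y) (V y), fun y ↦ g.symm y (Y y) (X y)]
  simp
  ring


/-- The `i`-th coordinate vector at `x`: the tangent space `T_x M` is represented in Mathlib as
`ℝⁿ` through the preferred chart at `x`. -/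
def coordVec (x : M) (i : Fin n) : TangentSpace (𝓡 n) x :=
  (EuclideanSpace.single i (1 : ℝ) : EuclideanSpace ℝ (Fin n))

/-- The `i`-th coordinate of a tangent vector at `x`, as a covector. -/
def coord (x : M) (i : Fin n) : TangentSpace (𝓡 n) x →L[ℝ] ℝ :=
  (EuclideanSpace.proj i : EuclideanSpace ℝ (Fin n) →L[ℝ] ℝ)

/-- The Gram matrix `(g_ij)` of the metric at `x` in the coordinate vectors. -/
def gram (x : M) : Matrix (Fin n) (Fin n) ℝ :=
  Matrix.of fun i j ↦ g.inner x (coordVec x i) (coordVec x j)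

theorem isUnit_det_gram (x : M) : IsUnit (g.gram x).det := by
  rw [isUnit_iff_ne_zero]
  intro h0
  obtain ⟨c, hc, h⟩ := Matrix.exists_vecMul_eq_zero_iff.mpr h0
  apply hc
  have key : ∑ i, c i • coordVec x i = 0 := by
    refine g.nondegenerate x _ fun w ↦ ?_
    have hw : w = ∑ j, coord x j w • coordVec x j := by
      have h := (EuclideanSpace.basisFun (Fin n) ℝ).sum_repr (w : EuclideanSpace ℝ (Fin n))
      simpa [coord, coordVec] using! h.symm
    rw [hw, map_sum]
    refine Finset.sum_eq_zero fun j _ ↦ ?_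
    have hj := congrFun h j
    simp only [Matrix.vecMul, dotProduct, gram, Matrix.of_apply, Pi.zero_apply] at hj
    simp [hj]
  funext i
  have key' : (∑ k, c k • EuclideanSpace.single k (1 : ℝ) : EuclideanSpace ℝ (Fin n)) = 0 := key
  have hi := congrArg (fun v : EuclideanSpace ℝ (Fin n) ↦ v i) key'
  simpa [Pi.single_apply] using hi

/-- The inverse matrix `(g^ij)`. -/
def invGram (x : M) : Matrix (Fin n) (Fin n) ℝ := (g.gram x)⁻¹

/-- The trace with respect to `g` of a `(0,2)`-tensor at `x`: `g^ij B_ij`. -/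
def trace (x : M) (B : TangentSpace (𝓡 n) x →L[ℝ] TangentSpace (𝓡 n) x →L[ℝ] ℝ) : ℝ :=
  ∑ i, ∑ j, g.invGram x i j * B (coordVec x i) (coordVec x j)

/-- The square norm with respect to `g` of a `(0,2)`-tensor at `x`:
`|B|² = g^ik g^jl B_ij B_kl`. -/
def normSqTensor (x : M) (B : TangentSpace (𝓡 n) x →L[ℝ] TangentSpace (𝓡 n) x →L[ℝ] ℝ) : ℝ :=
  ∑ i, ∑ j, ∑ k, ∑ l, g.invGram x i k * g.invGram x j l *
    B (coordVec x i) (coordVec x j) * B (coordVec x k) (coordVec x l)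

/-- The gradient: `g(grad f, v) = df(v)`. -/
def grad (f : M → ℝ) (x : M) : TangentSpace (𝓡 n) x := g.sharp x (mvfderiv (𝓡 n) f x)

/-- `|grad f|²_g = g(grad f, grad f)`. -/
def normSqGrad (f : M → ℝ) (x : M) : ℝ := g.inner x (g.grad f x) (g.grad f x)

/-- The tensor `(Y, X) ↦ η(X) Y + η(Y) X + g(X, Y) η^♯`. -/
def oneFormTensor (η : Π x : M, TangentSpace (𝓡 n) x →L[ℝ] ℝ) (x : M) :
    TangentSpace (𝓡 n) x →L[ℝ] TangentSpace (𝓡 n) x →L[ℝ] TangentSpace (𝓡 n) x :=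
  (LinearMap.mk₂ ℝ (fun v u ↦ η x u • v + η x v • u + g.inner x u v • g.sharp x (η x))
    (by intros; simp; module) (by intros; simp; module) (by intros; simp; module)
    (by intros; simp; module)).toContinuousBilinearMap

/-- The connection `∇^η = ∇^g + η ⊗ I + I ⊗ η + g ⊗ ξ`, where `ξ = η^♯`, that is,
`∇^η_X Y = ∇^g_X Y + η(X) Y + η(Y) X + g(X, Y) ξ`. -/
def oneFormConnection (η : Π x : M, TangentSpace (𝓡 n) x →L[ℝ] ℝ) :
    CovariantDerivative (𝓡 n) (EuclideanSpace ℝ (Fin n)) (TangentSpace (𝓡 n) : M → Type _) :=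
  g.leviCivita.addOneForm (g.oneFormTensor η)

theorem oneFormConnection_apply (η : Π x : M, TangentSpace (𝓡 n) x →L[ℝ] ℝ)
    (Y : Π x : M, TangentSpace (𝓡 n) x) (x : M) (v : TangentSpace (𝓡 n) x) :
    g.oneFormConnection η Y x v = g.leviCivita Y x v + (η x v • Y x + η x (Y x) • v +
      g.inner x v (Y x) • g.sharp x (η x)) := rfl

/-- The curvature `R(u, v) w = ∇_U ∇_V W - ∇_V ∇_U W - ∇_[U, V] W` at `x` of an affine connection,
computed with the smooth local extensions `U`, `V`, `W` of the tangent vectors `u`, `v`, `w` that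
have constant components in the preferred chart at `x`. -/
def curvature (cov : CovariantDerivative (𝓡 n) (EuclideanSpace ℝ (Fin n))
    (TangentSpace (𝓡 n) : M → Type _)) (x : M) (u v w : TangentSpace (𝓡 n) x) :
    TangentSpace (𝓡 n) x :=
  let U : Π y : M, TangentSpace (𝓡 n) y := FiberBundle.extend (EuclideanSpace ℝ (Fin n)) u
  let V : Π y : M, TangentSpace (𝓡 n) y := FiberBundle.extend (EuclideanSpace ℝ (Fin n)) v
  let W : Π y : M, TangentSpace (𝓡 n) y := FiberBundle.extend (EuclideanSpace ℝ (Fin n)) w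
  cov (fun y ↦ cov W y (V y)) x u - cov (fun y ↦ cov W y (U y)) x v
    - cov W x (mlieBracket (𝓡 n) U V x)

/-- The component `Ric(e_j, e_k) = tr (u ↦ R(u, e_j) e_k)` of the Ricci tensor. -/
def ricciComponent (cov : CovariantDerivative (𝓡 n) (EuclideanSpace ℝ (Fin n))
    (TangentSpace (𝓡 n) : M → Type _)) (x : M) (j k : Fin n) : ℝ :=
  ∑ i, coord x i (curvature cov x (coordVec x i) (coordVec x j) (coordVec x k))

/-- The Ricci tensor `Ric(Y, Z) = tr (X ↦ R(X, Y) Z)` of an affine connection, the bilinear form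
with the components `Ric(e_j, e_k)`. -/
def ricci (cov : CovariantDerivative (𝓡 n) (EuclideanSpace ℝ (Fin n))
    (TangentSpace (𝓡 n) : M → Type _)) (x : M) :
    TangentSpace (𝓡 n) x →L[ℝ] TangentSpace (𝓡 n) x →L[ℝ] ℝ :=
  ∑ j, ∑ k, ricciComponent cov x j k • (coord x j).smulRight (coord x k)

/-- The Ricci operator `Q` of an affine connection: `g(Q v, w) = Ric(v, w)`. -/
def ricciOperator (cov : CovariantDerivative (𝓡 n) (EuclideanSpace ℝ (Fin n))
    (TangentSpace (𝓡 n) : M → Type _)) (x : M) :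
    TangentSpace (𝓡 n) x →L[ℝ] TangentSpace (𝓡 n) x :=
  LinearMap.toContinuousLinearMap (g.sharp x ∘ₗ (ricci cov x).toLinearMap)

theorem inner_ricciOperator (cov : CovariantDerivative (𝓡 n) (EuclideanSpace ℝ (Fin n))
    (TangentSpace (𝓡 n) : M → Type _)) (x : M) (v w : TangentSpace (𝓡 n) x) :
    g.inner x (g.ricciOperator cov x v) w = ricci cov x v w :=
  g.inner_sharp x _ w

/-- The scalar curvature `scal^{(g, ∇)}`, the trace of the Ricci tensor of `∇` with respect
to `g`. -/
def scal (cov : CovariantDerivative (𝓡 n) (EuclideanSpace ℝ (Fin n))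
    (TangentSpace (𝓡 n) : M → Type _)) (x : M) : ℝ :=
  g.trace x (ricci cov x)

/-- The Hessian `Hess^∇(f)(X, Y) = g(∇_X grad f, Y)`. -/
def hessian (cov : CovariantDerivative (𝓡 n) (EuclideanSpace ℝ (Fin n))
    (TangentSpace (𝓡 n) : M → Type _)) (f : M → ℝ) (x : M) :
    TangentSpace (𝓡 n) x →L[ℝ] TangentSpace (𝓡 n) x →L[ℝ] ℝ :=
  g.inner x ∘L cov (g.grad f) x

/-- `(∇, J, ξ, λ)` is an almost soliton: `∇ ξ + J = λ I`, with `λ` a smooth function. It is called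
a gradient almost soliton when `ξ` is a gradient. -/
structure IsAlmostSoliton (cov : CovariantDerivative (𝓡 n) (EuclideanSpace ℝ (Fin n))
    (TangentSpace (𝓡 n) : M → Type _))
    (J : Π x : M, TangentSpace (𝓡 n) x →L[ℝ] TangentSpace (𝓡 n) x)
    (ξ : Π x : M, TangentSpace (𝓡 n) x) (lam : M → ℝ) : Prop where
  contMDiff : ContMDiff (𝓡 n) 𝓘(ℝ, ℝ) ∞ lam
  equation (x : M) : cov ξ x + J x = lam x • ContinuousLinearMap.id ℝ (TangentSpace (𝓡 n) x)

/-- The matrix of the metric at the point with coordinates `y` in a chart `e`: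
`g_ij = g(∂_i, ∂_j)`, where `∂_i` is the image of the `i`-th standard vector under the derivative
of `e⁻¹`. -/
def chartGram (e : OpenPartialHomeomorph M (EuclideanSpace ℝ (Fin n)))
    (y : EuclideanSpace ℝ (Fin n)) : Matrix (Fin n) (Fin n) ℝ :=
  Matrix.of fun i j ↦ g.inner (e.symm y)
    (mfderiv 𝓘(ℝ, EuclideanSpace ℝ (Fin n)) (𝓡 n) e.symm y
      (EuclideanSpace.single i (1 : ℝ) : EuclideanSpace ℝ (Fin n)))
    (mfderiv 𝓘(ℝ, EuclideanSpace ℝ (Fin n)) (𝓡 n) e.symm y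
      (EuclideanSpace.single j (1 : ℝ) : EuclideanSpace ℝ (Fin n)))

/-- The volume measure `dμ_g`: with a smooth partition of unity `(ρ_p)` subordinate to the domains
of the charts `e_p`, it is the sum over `p` of the measures `ρ_p √|det (g_ij)| dy` on the target of
`e_p` (where `dy` is the Lebesgue measure), transported to `M`. It does not depend on the choice of
the partition of unity. -/
def volumeMeasure [T2Space M] [CompactSpace M] [MeasurableSpace M] [BorelSpace M] : Measure M :=
  let ρ : SmoothPartitionOfUnity M (𝓡 n) M univ :=
    (SmoothPartitionOfUnity.exists_isSubordinate_chartAt_source (𝓡 n) M).choose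
  Measure.sum fun p : M ↦
    let e := chartAt (EuclideanSpace ℝ (Fin n)) p
    (((volume : Measure (EuclideanSpace ℝ (Fin n))).restrict e.target).withDensity fun y ↦
      ENNReal.ofReal (ρ p (e.symm y) * √|(g.chartGram e y).det|)).map e.symm

end PseudoRiemannianMetric
end

open Bundle Set MeasureTheory VectorField
open scoped Manifold ContDiff Topology

set_option linter.unusedSectionVars false

noncomputable section

namespace PseudoRiemannianMetric

variable {n : ℕ} {M : Type*} [TopologicalSpace M]
  [ChartedSpace (EuclideanSpace ℝ (Fin n)) M] [IsManifold (𝓡 n) ∞ M]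

/-! Write `ξ = grad f`, `Δf = tr ∇^g ξ`. Both formulas integrate a pointwise identity. Since `|ξ|² =
c` is constant and `Hess(f)` is symmetric, `g(∇_X ξ, ξ) = 0` and `∇_ξ ξ = 0`. Tracing `R(·, ξ)ξ`
then gives Bochner's formula `Ric(ξ, ξ) = -ξ(Δf) - |Hess(f)|²` (`ricci_grad_grad`). A computation
with the difference tensor of the two connections gives `Ric^{df} = Ric^g + (Δf + nc) g - n Hess(f)
+ (n - 2) df ⊗ df` (`ricci_oneFormConnection`); likewise `Hess^{df}(f) = Hess(f) + 2 df ⊗ df + c g`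
(`hessian_oneFormConnection`). Each soliton equation is used twice. Its trace expresses `scal` as
`nλ - Δf` minus a constant, so `ξ(Δf)` can be traded for `nξ(λ) - ξ(scal)`. Its value on `(ξ, ξ)`,
where the Hessian vanishes, gives `Ric(ξ, ξ)`. Bochner's formula connects the two. For the almost
soliton a term `c Δf` is left over. No divergence theorem is needed to integrate it away: on a
nonempty compact manifold `f` has a critical point, so `c = 0`; on the empty one every integral is
zero. It remains to integrate term by term, which requires smooth integrands and a finite volume
measure. -/

/-! ### Smooth functions and vector fields on open sets. -/

/-- Smoothness of a vector field on a set. -/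
abbrev VSmoothOn (V : Π x : M, TangentSpace (𝓡 n) x) (u : Set M) : Prop :=
  ContMDiffOn (𝓡 n) ((𝓡 n).prod 𝓘(ℝ, EuclideanSpace ℝ (Fin n))) ∞
    (fun y ↦ TotalSpace.mk' (EuclideanSpace ℝ (Fin n)) y (V y)) u

/-- Smoothness of a function on a set. -/
abbrev SmoothOn (f : M → ℝ) (u : Set M) : Prop := ContMDiffOn (𝓡 n) 𝓘(ℝ, ℝ) ∞ f u

variable {u : Set M} {x : M} {V W σ : Π x : M, TangentSpace (𝓡 n) x} {f h : M → ℝ}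

theorem VSmoothOn.vdiffAt (hV : VSmoothOn V u) (hu : IsOpen u) (hx : x ∈ u) : VDiffAt V x :=
  (hV.contMDiffAt (hu.mem_nhds hx)).mdifferentiableAt (by simp)

theorem SmoothOn.mdiffAt (hf : SmoothOn (n := n) f u) (hu : IsOpen u) (hx : x ∈ u) :
    MDifferentiableAt (𝓡 n) 𝓘(ℝ, ℝ) f x :=
  (hf.contMDiffAt (hu.mem_nhds hx)).mdifferentiableAt (by simp)

theorem VSmoothOn.smul (hf : SmoothOn (n := n) f u) (hV : VSmoothOn V u) :
    VSmoothOn (fun y ↦ f y • V y) u :=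
  ContMDiffOn.smul_section hf hV

theorem VSmoothOn.add (hV : VSmoothOn V u) (hW : VSmoothOn W u) :
    VSmoothOn (fun y ↦ V y + W y) u :=
  ContMDiffOn.add_section hV hW

theorem VSmoothOn.sum {ι : Type*} {s : Finset ι} {V : ι → Π x : M, TangentSpace (𝓡 n) x}
    (hV : ∀ i, VSmoothOn (V i) u) : VSmoothOn (fun y ↦ ∑ i ∈ s, V i y) u :=
  ContMDiffOn.sum_section fun i _ ↦ hV i

theorem VSmoothOn.mlieBracket (hV : VSmoothOn V u) (hW : VSmoothOn W u) (hu : IsOpen u) :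
    VSmoothOn (mlieBracket (𝓡 n) V W) u := by
  intro x hx
  -- The bracket costs one derivative, which is harmless because `∞ + 1 = ∞`.
  have : IsManifold (𝓡 n) ((⊤ : ℕ∞) + 1) M := inferInstanceAs (IsManifold (𝓡 n) ∞ M)
  have : IsManifold (𝓡 n) (minSmoothness ℝ 2) M := by
    simpa using! inferInstanceAs (IsManifold (𝓡 n) 2 M)
  have : IsManifold (𝓡 n) (minSmoothness ℝ 3) M := by
    simpa using! inferInstanceAs (IsManifold (𝓡 n) 3 M)
  exact (ContMDiffAt.mlieBracket_vectorField (m := ⊤) (n := ⊤) (hV.contMDiffAt (hu.mem_nhds hx))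
    (hW.contMDiffAt (hu.mem_nhds hx)) (by simp)).contMDiffWithinAt

/-- The function is the fibre component of the tangent map of `f` composed with the section `V`. -/
theorem SmoothOn.mvfderiv (hf : SmoothOn (n := n) f u) (hV : VSmoothOn V u) (hu : IsOpen u) :
    SmoothOn (n := n) (fun y ↦ mvfderiv (𝓡 n) f y (V y)) u := by
  have h1 := hf.contMDiffOn_tangentMapWithin (m := ∞) (by simp) hu.uniqueMDiffOn
  have h2 := h1.comp hV (fun y hy ↦ hy)
  have h3 := (contMDiff_snd_tangentBundle_modelSpace ℝ 𝓘(ℝ, ℝ) (n := ∞)).comp_contMDiffOn h2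
  refine h3.congr fun y hy ↦ ?_
  simp only [Function.comp, tangentMapWithin]
  change _ = mfderivWithin (𝓡 n) 𝓘(ℝ, ℝ) f u y (V y)
  rw [mfderivWithin_of_isOpen hu hy]
  rfl

variable (g : PseudoRiemannianMetric n M)

theorem smoothOn_inner (hV : VSmoothOn V u) (hW : VSmoothOn W u) :
    SmoothOn (n := n) (fun y ↦ g.inner y (V y) (W y)) u := by
  have h := ContMDiffOn.clm_bundle_apply₂ (F₁ := EuclideanSpace ℝ (Fin n))
    (F₂ := EuclideanSpace ℝ (Fin n)) (F₃ := ℝ) (E₁ := fun y : M ↦ TangentSpace (𝓡 n) y)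
    (E₂ := fun y : M ↦ TangentSpace (𝓡 n) y) (E₃ := Bundle.Trivial M ℝ) (b := fun y : M ↦ y)
    (IM := 𝓡 n) (ψ := g.inner) g.contMDiff.contMDiffOn hV hW
  intro y hy
  have := h y hy
  rw [contMDiffWithinAt_totalSpace] at this
  exact this.2

theorem smoothOn_koszul (hσ : VSmoothOn σ u) (hV : VSmoothOn V u) (hW : VSmoothOn W u)
    (hu : IsOpen u) : SmoothOn (n := n) (g.koszul σ V W) u := by
  unfold koszul
  refine contMDiffOn_const.mul ?_
  have a := (g.smoothOn_inner hσ hW).mvfderiv hV hu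
  have b := (g.smoothOn_inner hW hV).mvfderiv hσ hu
  have c := (g.smoothOn_inner hV hσ).mvfderiv hW hu
  exact ((((a.add b).sub c).add (g.smoothOn_inner (hV.mlieBracket hσ hu) hW)).sub
    (g.smoothOn_inner (hσ.mlieBracket hW hu) hV)).add
    (g.smoothOn_inner (hW.mlieBracket hV hu) hσ)

/-! ### Coordinate frames, and smoothness tested by frames and by the metric. -/

/-- The `i`-th vector field of the coordinate frame around `p`. -/
def frame (p : M) (i : Fin n) : Π y : M, TangentSpace (𝓡 n) y :=
  FiberBundle.extend (EuclideanSpace ℝ (Fin n)) (coordVec p i)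

/-- The `i`-th covector field of the frame dual to `frame p`. -/
def coframe (p : M) (i : Fin n) (y : M) : TangentSpace (𝓡 n) y →L[ℝ] ℝ :=
  (EuclideanSpace.proj i : EuclideanSpace ℝ (Fin n) →L[ℝ] ℝ) ∘L
    (trivializationAt (EuclideanSpace ℝ (Fin n)) (TangentSpace (𝓡 n)) p).continuousLinearMapAt ℝ y

theorem trivializationAt_self (p : M) (v : TangentSpace (𝓡 n) p) :
    (trivializationAt (EuclideanSpace ℝ (Fin n)) (TangentSpace (𝓡 n)) p ⟨p, v⟩).2 = v :=
  (tangentBundleCore (𝓡 n) M).coordChange_self (achart _ p) p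
    (mem_chart_source (EuclideanSpace ℝ (Fin n)) p) v

theorem frame_self (p : M) (i : Fin n) : frame p i p = coordVec p i := by
  simp [frame]

theorem frame_eq (p : M) (i : Fin n) {y : M}
    (hy : y ∈ (chartAt (EuclideanSpace ℝ (Fin n)) p).source) :
    frame p i y = (trivializationAt (EuclideanSpace ℝ (Fin n)) (TangentSpace (𝓡 n)) p).symmL ℝ y
      (EuclideanSpace.single i (1 : ℝ)) := by
  rw [Trivialization.symmL_apply _ hy]
  simp only [frame, FiberBundle.extend, trivializationAt_self]
  rfl

theorem coframe_apply (p : M) (i : Fin n) {y : M}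
    (hy : y ∈ (chartAt (EuclideanSpace ℝ (Fin n)) p).source) (v : TangentSpace (𝓡 n) y) :
    coframe p i y v =
      (trivializationAt (EuclideanSpace ℝ (Fin n)) (TangentSpace (𝓡 n)) p ⟨y, v⟩).2 i := by
  rw [← Trivialization.continuousLinearMapAt_apply_of_mem (R := ℝ) _ (b := y) hy]
  rfl

theorem coframe_self (p : M) (i : Fin n) : coframe p i p = coord p i := by
  ext v
  rw [coframe_apply p i (mem_chart_source _ p), trivializationAt_self]
  rfl

theorem vsmoothOn_iff_coframe (p : M) (hu : IsOpen u)
    (hup : u ⊆ (chartAt (EuclideanSpace ℝ (Fin n)) p).source) :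
    VSmoothOn V u ↔ ∀ i, SmoothOn (n := n) (fun y ↦ coframe p i y (V y)) u := by
  rw [VSmoothOn, Trivialization.contMDiffOn_section_iff
    (trivializationAt (EuclideanSpace ℝ (Fin n)) (TangentSpace (𝓡 n)) p) hu hup]
  have h : ContMDiffOn (𝓡 n) 𝓘(ℝ, EuclideanSpace ℝ (Fin n)) ∞ (fun y ↦
      (trivializationAt (EuclideanSpace ℝ (Fin n)) (TangentSpace (𝓡 n)) p ⟨y, V y⟩).2) u ↔
      ∀ i, SmoothOn (n := n) (fun y ↦ (trivializationAt (EuclideanSpace ℝ (Fin n))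
        (TangentSpace (𝓡 n)) p ⟨y, V y⟩).2 i) u := by
    constructor
    · intro h i
      exact (EuclideanSpace.proj i :
        EuclideanSpace ℝ (Fin n) →L[ℝ] ℝ).contMDiff.comp_contMDiffOn h
    · intro h
      have h2 := (contMDiffOn_pi_space.2 h)
      exact (EuclideanSpace.equiv (Fin n) ℝ).symm.toContinuousLinearMap.contMDiff.comp_contMDiffOn h2
  rw [h]
  exact forall_congr' fun i ↦ contMDiffOn_congr fun y hy ↦ (coframe_apply p i (hup hy) (V y)).symm

theorem coframe_frame (p : M) (i j : Fin n) {y : M}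
    (hy : y ∈ (chartAt (EuclideanSpace ℝ (Fin n)) p).source) :
    coframe p i y (frame p j y) = if i = j then 1 else 0 := by
  rw [frame_eq p j hy, coframe, ContinuousLinearMap.comp_apply,
    Trivialization.continuousLinearMapAt_symmL _ hy]
  simp

theorem vsmoothOn_frame (p : M) (i : Fin n) :
    VSmoothOn (frame p i) (chartAt (EuclideanSpace ℝ (Fin n)) p).source := by
  rw [vsmoothOn_iff_coframe p (chartAt _ p).open_source subset_rfl]
  intro j
  exact (contMDiffOn_const (c := if j = i then (1 : ℝ) else 0)).congr
    fun y hy ↦ coframe_frame p j i hy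

theorem sum_coframe_smul_frame (p : M) {y : M}
    (hy : y ∈ (chartAt (EuclideanSpace ℝ (Fin n)) p).source) (v : TangentSpace (𝓡 n) y) :
    ∑ i, coframe p i y v • frame p i y = v := by
  set t := trivializationAt (EuclideanSpace ℝ (Fin n)) (TangentSpace (𝓡 n)) p
  have h1 := (EuclideanSpace.basisFun (Fin n) ℝ).sum_repr (t.continuousLinearMapAt ℝ y v)
  have h2 := congrArg (t.symmL ℝ y) h1
  rw [Trivialization.symmL_continuousLinearMapAt _ hy, map_sum] at h2
  conv_rhs => rw [← h2]
  refine Finset.sum_congr rfl fun i _ ↦ ?_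
  rw [frame_eq p i hy, map_smul]
  simp [coframe, t]

/-- A vector field is smooth when its metric products with smooth vector fields are smooth. -/
theorem vsmoothOn_of_inner (hu : IsOpen u)
    (h : ∀ (w : Set M) (W : Π x : M, TangentSpace (𝓡 n) x), IsOpen w → w ⊆ u → VSmoothOn W w →
      SmoothOn (n := n) (fun y ↦ g.inner y (V y) (W y)) w) : VSmoothOn V u := by
  intro p hp
  set w := u ∩ (chartAt (EuclideanSpace ℝ (Fin n)) p).source with hw
  have hwo : IsOpen w := hu.inter (chartAt _ p).open_source
  have hpw : p ∈ w := ⟨hp, mem_chart_source _ p⟩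
  have hE : ∀ i, VSmoothOn (frame p i) w := fun i ↦ (vsmoothOn_frame p i).mono inter_subset_right
  suffices hV : VSmoothOn V w from (hV.contMDiffAt (hwo.mem_nhds hpw)).contMDiffWithinAt
  rw [vsmoothOn_iff_coframe p hwo inter_subset_right]
  -- The frame components of `V` solve a linear system with matrix `G` and right-hand side `g(V,
  -- E_i)`. By Cramer's rule they are quotients of smooth determinants, and the denominator is
  -- nonzero because the metric is nondegenerate.
  let G (y : M) : Matrix (Fin n) (Fin n) ℝ :=
    Matrix.of fun i j ↦ g.inner y (frame p i y) (frame p j y)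
  have hG : ∀ i j, SmoothOn (n := n) (fun y ↦ G y i j) w := fun i j ↦
    g.smoothOn_inner (hE i) (hE j)
  have hdet : ∀ A : M → Matrix (Fin n) (Fin n) ℝ, (∀ i j, SmoothOn (n := n) (fun y ↦ A y i j) w) →
      SmoothOn (n := n) (fun y ↦ (A y).det) w := by
    intro A hA
    simp only [Matrix.det_apply']
    exact contMDiffOn_finsetSum fun s _ ↦ contMDiffOn_const.mul
      (contMDiffOn_finsetProd fun i _ ↦ hA _ _)
  have hb : ∀ j, SmoothOn (n := n) (fun y ↦ g.inner y (V y) (frame p j y)) w := fun j ↦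
    h w _ hwo inter_subset_left (hE j)
  have hsys : ∀ y ∈ w, (G y).mulVec (fun j ↦ coframe p j y (V y)) =
      fun i ↦ g.inner y (V y) (frame p i y) := by
    intro y hy
    funext i
    conv_rhs => rw [← sum_coframe_smul_frame p hy.2 (V y), map_sum, sum_apply]
    simp only [Matrix.mulVec, dotProduct, G, Matrix.of_apply, map_smul, smul_apply, smul_eq_mul]
    refine Finset.sum_congr rfl fun j _ ↦ ?_
    rw [g.symm y (frame p i y), mul_comm]
  have hdet0 : ∀ y ∈ w, (G y).det ≠ 0 := by
    intro y hy h0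
    obtain ⟨c, hc, hc0⟩ := Matrix.exists_vecMul_eq_zero_iff.mpr h0
    apply hc
    have key : ∑ i, c i • frame p i y = 0 := by
      refine g.nondegenerate y _ fun v ↦ ?_
      rw [← sum_coframe_smul_frame p hy.2 v, map_sum]
      refine Finset.sum_eq_zero fun j _ ↦ ?_
      have hj := congrFun hc0 j
      simp only [Matrix.vecMul, dotProduct, G, Matrix.of_apply, Pi.zero_apply] at hj
      simp [hj]
    funext i
    have := congrArg (coframe p i y) key
    simpa [coframe_frame p i _ hy.2] using this
  intro i
  have hcr : SmoothOn (n := n) (fun y ↦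
      (G y).cramer (fun i ↦ g.inner y (V y) (frame p i y)) i / (G y).det) w := by
    refine ContMDiffOn.div₀ ?_ (hdet G hG) hdet0
    simp only [Matrix.cramer_apply]
    refine hdet _ fun k j ↦ ?_
    by_cases hj : j = i
    · subst hj
      simpa [Matrix.updateCol_apply] using hb k
    · simpa [Matrix.updateCol_apply, hj] using hG k j
  refine hcr.congr fun y hy ↦ ?_
  rw [eq_div_iff (hdet0 y hy), ← hsys y hy, Matrix.cramer_eq_adjugate_mulVec,
    Matrix.mulVec_mulVec, Matrix.adjugate_mul, Matrix.smul_mulVec, Matrix.one_mulVec]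
  simp [mul_comm]

/-- Koszul's formula gives smooth products with all smooth fields, and that is enough by duality. -/
theorem vsmoothOn_leviCivita (hu : IsOpen u) (hσ : VSmoothOn σ u) (hV : VSmoothOn V u) :
    VSmoothOn (fun y ↦ g.leviCivita σ y (V y)) u := by
  refine g.vsmoothOn_of_inner hu fun w W hw hwu hW ↦ ?_
  refine (g.smoothOn_koszul (hσ.mono hwu) (hV.mono hwu) hW hw).congr fun y hy ↦ ?_
  exact g.inner_leviCivitaFun (hσ.vdiffAt hu (hwu hy)) (hV.vdiffAt hu (hwu hy)) (hW.vdiffAt hw hy)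

theorem inner_grad (f : M → ℝ) (x : M) (v : TangentSpace (𝓡 n) x) :
    g.inner x (g.grad f x) v = mvfderiv (𝓡 n) f x v :=
  g.inner_sharp x _ v

theorem vsmoothOn_grad (hu : IsOpen u) (hf : SmoothOn (n := n) f u) : VSmoothOn (g.grad f) u := by
  refine g.vsmoothOn_of_inner hu fun w W hw hwu hW ↦ ?_
  simp only [inner_grad]
  exact SmoothOn.mvfderiv (hf.mono hwu) hW hw

/-- The derivative along a Lie bracket is the commutator of the derivatives. -/
theorem mvfderiv_mlieBracket (hu : IsOpen u) (hx : x ∈ u) (hf : SmoothOn (n := n) f u)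
    (hV : VSmoothOn V u) (hW : VSmoothOn W u) :
    mvfderiv (𝓡 n) f x (mlieBracket (𝓡 n) V W x) =
      mvfderiv (𝓡 n) (fun y ↦ mvfderiv (𝓡 n) f y (W y)) x (V x) -
        mvfderiv (𝓡 n) (fun y ↦ mvfderiv (𝓡 n) f y (V y)) x (W x) := by
  by_cases hall : ∀ z : TangentSpace (𝓡 n) x, z = 0
  · rw [hall (mlieBracket (𝓡 n) V W x), hall (V x), hall (W x)]; simp
  push Not at hall
  obtain ⟨z, hz⟩ := hall
  set w := u ∩ (chartAt (EuclideanSpace ℝ (Fin n)) x).source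
  have hwo : IsOpen w := hu.inter (chartAt _ x).open_source
  have hxw : x ∈ w := ⟨hx, mem_chart_source _ x⟩
  replace hf : SmoothOn (n := n) f w := hf.mono inter_subset_left
  replace hV : VSmoothOn V w := hV.mono inter_subset_left
  replace hW : VSmoothOn W w := hW.mono inter_subset_left
  obtain ⟨Z, hZ, hZx⟩ : ∃ Z : Π x : M, TangentSpace (𝓡 n) x, VSmoothOn Z w ∧ Z x ≠ 0 := by
    by_contra! hcon
    apply hz
    rw [← sum_coframe_smul_frame x hxw.2 z]
    exact Finset.sum_eq_zero fun i _ ↦ by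
      rw [hcon _ ((vsmoothOn_frame x i).mono inter_subset_right), smul_zero]
  have : IsManifold (𝓡 n) (minSmoothness ℝ 3) M := by
    simpa using! inferInstanceAs (IsManifold (𝓡 n) 3 M)
  have two : ∀ {V : Π x : M, TangentSpace (𝓡 n) x}, VSmoothOn V w →
      ContMDiffAt (𝓡 n) ((𝓡 n).prod 𝓘(ℝ, EuclideanSpace ℝ (Fin n))) (minSmoothness ℝ 2)
        (fun y ↦ TotalSpace.mk' (EuclideanSpace ℝ (Fin n)) y (V y)) x := fun hV ↦
    (hV.contMDiffAt (hwo.mem_nhds hxw)).of_le (by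
      rw [minSmoothness_of_isRCLikeNormedField]; exact ENat.LEInfty.out)
  have br : ∀ {V : Π x : M, TangentSpace (𝓡 n) x}, VSmoothOn V w →
      ∀ {a : M → ℝ}, SmoothOn (n := n) a w → ∀ {Z : Π x : M, TangentSpace (𝓡 n) x},
      VSmoothOn Z w → ∀ y ∈ w, mlieBracket (𝓡 n) V (a • Z) y =
      mvfderiv (𝓡 n) a y (V y) • Z y + a y • mlieBracket (𝓡 n) V Z y := fun hV a ha Z hZ y hy ↦
    mlieBracket_smul_right (ha.mdiffAt hwo hy) (hZ.vdiffAt hwo hy)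
  have expand : ∀ {U V : Π x : M, TangentSpace (𝓡 n) x}, VSmoothOn U w → VSmoothOn V w →
      mlieBracket (𝓡 n) U (mlieBracket (𝓡 n) V (f • Z)) x =
      mvfderiv (𝓡 n) (fun y ↦ mvfderiv (𝓡 n) f y (V y)) x (U x) • Z x
      + mvfderiv (𝓡 n) f x (V x) • mlieBracket (𝓡 n) U Z x
      + (mvfderiv (𝓡 n) f x (U x) • mlieBracket (𝓡 n) V Z x
      + f x • mlieBracket (𝓡 n) U (mlieBracket (𝓡 n) V Z) x) := by
    intro U V hU hV
    have e : mlieBracket (𝓡 n) V (f • Z) =ᶠ[𝓝 x] ((fun y ↦ mvfderiv (𝓡 n) f y (V y)) • Z)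
        + f • mlieBracket (𝓡 n) V Z := by
      filter_upwards [hwo.mem_nhds hxw] with y hy
      exact br hV hf hZ y hy
    have hdf := hf.mvfderiv hV hwo
    have hVZ := hV.mlieBracket hZ hwo
    rw [(Filter.EventuallyEq.refl _ U).mlieBracket_vectorField_eq e,
      mlieBracket_add_right ((hdf.mdiffAt hwo hxw).smul_section (hZ.vdiffAt hwo hxw))
        ((hf.mdiffAt hwo hxw).smul_section (hVZ.vdiffAt hwo hxw)),
      br hU hdf hZ x hxw, br hU hf hVZ x hxw]
  -- Jacobi's identity for `V, W, fZ` is expanded by the Leibniz rule. Jacobi's identity for `V, W,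
  -- Z` removes the terms in which `f` is not differentiated, the mixed first-order terms cancel,
  -- and the claimed identity is left as the coefficient of `Z x`.
  have jac := leibniz_identity_mlieBracket_apply (two hV) (two hW) (two (hZ.smul hf))
  have jac' := leibniz_identity_mlieBracket_apply (two hV) (two hW) (two hZ)
  change mlieBracket (𝓡 n) V (mlieBracket (𝓡 n) W (f • Z)) x =
    mlieBracket (𝓡 n) (mlieBracket (𝓡 n) V W) (f • Z) x +
    mlieBracket (𝓡 n) W (mlieBracket (𝓡 n) V (f • Z)) x at jac
  rw [expand hV hW, expand hW hV, br (hV.mlieBracket hW hwo) hf hZ x hxw, jac'] at jac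
  have key : (mvfderiv (𝓡 n) (fun y ↦ mvfderiv (𝓡 n) f y (W y)) x (V x) -
      mvfderiv (𝓡 n) (fun y ↦ mvfderiv (𝓡 n) f y (V y)) x (W x) -
      mvfderiv (𝓡 n) f x (mlieBracket (𝓡 n) V W x)) • Z x = 0 := by
    rw [sub_smul, sub_smul, ← sub_eq_zero.mpr jac]
    module
  have := (smul_eq_zero.mp key).resolve_right hZx
  linarith

/-! ### Pointwise rules for an affine connection. -/

section CovariantDerivative

variable (cov : CovariantDerivative (𝓡 n) (EuclideanSpace ℝ (Fin n))
    (TangentSpace (𝓡 n) : M → Type _)) {x : M} {V W : Π x : M, TangentSpace (𝓡 n) x} {f : M → ℝ}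

theorem cov_add (hV : VDiffAt V x) (hW : VDiffAt W x) (v : TangentSpace (𝓡 n) x) :
    cov (fun y ↦ V y + W y) x v = cov V x v + cov W x v :=
  congrArg (· v) (cov.isCovariantDerivativeOnUniv.add hV hW)

theorem cov_smul (hf : MDifferentiableAt (𝓡 n) 𝓘(ℝ, ℝ) f x) (hV : VDiffAt V x)
    (v : TangentSpace (𝓡 n) x) :
    cov (fun y ↦ f y • V y) x v = f x • cov V x v + mvfderiv (𝓡 n) f x v • V x :=
  congrArg (· v) (cov.isCovariantDerivativeOnUniv.leibniz hV hf)

theorem cov_congr (hV : VDiffAt V x) (h : V =ᶠ[𝓝 x] W) : cov V x = cov W x := by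
  refine cov.isCovariantDerivativeOnUniv.congr_of_eventuallyEq hV ?_ Filter.univ_mem h
  exact hV.congr_of_eventuallyEq (h.symm.mono fun y hy ↦ congrArg (TotalSpace.mk' _ y) hy)

theorem cov_zero (v : TangentSpace (𝓡 n) x) :
    cov (fun y ↦ (0 : TangentSpace (𝓡 n) y)) x v = 0 := by
  have := congrFun (CovariantDerivative.zero cov) x
  exact congrArg (· v) this

theorem cov_sum {ι : Type*} (s : Finset ι) {V : ι → Π x : M, TangentSpace (𝓡 n) x}
    (hV : ∀ i, VDiffAt (V i) x) (v : TangentSpace (𝓡 n) x) :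
    cov (fun y ↦ ∑ i ∈ s, V i y) x v = ∑ i ∈ s, cov (V i) x v := by
  classical
  induction s using Finset.induction_on with
  | empty => simpa using cov_zero cov v
  | insert a s ha ih =>
    simp only [Finset.sum_insert ha]
    rw [cov_add cov (hV a) (MDifferentiableAt.sum_section fun i _ ↦ hV i), ih]

end CovariantDerivative

variable (g : PseudoRiemannianMetric n M)

/-! ### Symmetry of the Hessian and gradients of constant square norm. -/

section Gradient

variable {x : M} {V W : Π x : M, TangentSpace (𝓡 n) x} {f : M → ℝ}

theorem mlieBracket_eq_leviCivita (hV : VDiffAt V x) (hW : VDiffAt W x) :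
    mlieBracket (𝓡 n) V W x = g.leviCivita W x (V x) - g.leviCivita V x (W x) :=
  ((CovariantDerivative.torsion_eq_zero_iff _).1 g.torsion_leviCivita hV hW).symm

/-- The Hessian of a smooth function is symmetric. -/
theorem inner_leviCivita_grad_comm (hf : ContMDiff (𝓡 n) 𝓘(ℝ, ℝ) ∞ f)
    (v w : TangentSpace (𝓡 n) x) :
    g.inner x (g.leviCivita (g.grad f) x v) w = g.inner x (g.leviCivita (g.grad f) x w) v := by
  set u := (chartAt (EuclideanSpace ℝ (Fin n)) x).source
  have hu : IsOpen u := (chartAt _ x).open_source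
  have hx : x ∈ u := mem_chart_source _ x
  have hext : ∀ z : TangentSpace (𝓡 n) x, ∃ Z : Π x : M, TangentSpace (𝓡 n) x,
      VSmoothOn Z u ∧ Z x = z := fun z ↦
    ⟨fun y ↦ ∑ i, coord x i z • frame x i y,
      VSmoothOn.sum fun i ↦ VSmoothOn.smul contMDiffOn_const (vsmoothOn_frame x i), by
      simp only [← coframe_self]; exact sum_coframe_smul_frame x hx z⟩
  obtain ⟨V, hV, rfl⟩ := hext v
  obtain ⟨W, hW, rfl⟩ := hext w
  have hξ : VSmoothOn (g.grad f) u := g.vsmoothOn_grad hu hf.contMDiffOn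
  have h1 := g.mvfderiv_inner (hξ.vdiffAt hu hx) (hW.vdiffAt hu hx) (V x)
  have h2 := g.mvfderiv_inner (hξ.vdiffAt hu hx) (hV.vdiffAt hu hx) (W x)
  -- Metric compatibility gives `V(Wf) = Hess(V, W) + df(∇_V W)`. Antisymmetrizing in `V, W` and
  -- using zero torsion leaves the antisymmetric part of the Hessian equal to zero.
  have h3 := mvfderiv_mlieBracket hu hx hf.contMDiffOn hV hW
  rw [g.mlieBracket_eq_leviCivita (hV.vdiffAt hu hx) (hW.vdiffAt hu hx), map_sub] at h3
  simp only [inner_grad] at h1 h2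
  linarith

variable {c : ℝ}

/-- Differentiate the constant function `g(grad f, grad f)`. -/
theorem inner_leviCivita_grad_self (hf : ContMDiff (𝓡 n) 𝓘(ℝ, ℝ) ∞ f)
    (hc : ∀ x, g.normSqGrad f x = c) (v : TangentSpace (𝓡 n) x) :
    g.inner x (g.leviCivita (g.grad f) x v) (g.grad f x) = 0 := by
  have hξ := (g.vsmoothOn_grad isOpen_univ hf.contMDiffOn).vdiffAt isOpen_univ (mem_univ x)
  have h1 := g.mvfderiv_inner hξ hξ v
  have h2 : (fun y ↦ g.inner y (g.grad f y) (g.grad f y)) = fun _ ↦ c := funext hc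
  rw [h2, mvfderiv_const, g.symm x (g.grad f x)] at h1
  simp only [zero_apply] at h1
  linarith

/-- By symmetry of the Hessian, `g(∇_ξ ξ, w) = g(∇_w ξ, ξ) = 0` for every `w`. -/
theorem leviCivita_grad_grad (hf : ContMDiff (𝓡 n) 𝓘(ℝ, ℝ) ∞ f)
    (hc : ∀ x, g.normSqGrad f x = c) :
    g.leviCivita (g.grad f) x (g.grad f x) = 0 :=
  g.nondegenerate x _ fun w ↦ by
    rw [g.inner_leviCivita_grad_comm hf, g.inner_leviCivita_grad_self hf hc]

end Gradient

/-! ### Tensoriality of the curvature and the Ricci tensor on arbitrary fields. -/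

section Curvature

variable (cov : CovariantDerivative (𝓡 n) (EuclideanSpace ℝ (Fin n))
    (TangentSpace (𝓡 n) : M → Type _))

/-- The curvature expression `∇_U ∇_V W - ∇_V ∇_U W - ∇_[U, V] W` of vector fields. -/
def curvatureField (U V W : Π x : M, TangentSpace (𝓡 n) x) (x : M) : TangentSpace (𝓡 n) x :=
  cov (fun y ↦ cov W y (V y)) x (U x) - cov (fun y ↦ cov W y (U y)) x (V x)
    - cov W x (mlieBracket (𝓡 n) U V x)

theorem curvature_coordVec (x : M) (i j k : Fin n) :
    curvature cov x (coordVec x i) (coordVec x j) (coordVec x k) =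
      curvatureField cov (frame x i) (frame x j) (frame x k) x := by
  simp only [curvature, curvatureField, frame, FiberBundle.extend_apply_self]

variable {u : Set M} {x : M} {U V W : Π x : M, TangentSpace (𝓡 n) x} {f : M → ℝ}

/-- The derivative of `f` produced by `∇_U` cancels the one produced by the bracket `[U, fV]`. -/
theorem curvatureField_smul_mid (hu : IsOpen u) (hx : x ∈ u)
    (hV : VSmoothOn V u) (hW : VSmoothOn W u) (hf : SmoothOn (n := n) f u) :
    curvatureField g.leviCivita U (fun y ↦ f y • V y) W x =
      f x • curvatureField g.leviCivita U V W x := by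
  have h1 := mlieBracket_smul_right (V := U) (SmoothOn.mdiffAt hf hu hx) (hV.vdiffAt hu hx)
  have h2 := (g.vsmoothOn_leviCivita hu hW hV).vdiffAt hu hx
  simp only [curvatureField, map_smul]
  rw [cov_smul _ (SmoothOn.mdiffAt hf hu hx) h2]
  change _ - _ - g.leviCivita W x (mlieBracket (𝓡 n) U (f • V) x) = _
  rw [h1, map_add, map_smul, map_smul]
  module

theorem curvatureField_add_mid (hu : IsOpen u) (hx : x ∈ u) {V' : Π x : M, TangentSpace (𝓡 n) x}
    (hV : VSmoothOn V u) (hV' : VSmoothOn V' u) (hW : VSmoothOn W u) :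
    curvatureField g.leviCivita U (fun y ↦ V y + V' y) W x =
      curvatureField g.leviCivita U V W x + curvatureField g.leviCivita U V' W x := by
  have h1 := mlieBracket_add_right (V := U) (hV.vdiffAt hu hx) (hV'.vdiffAt hu hx)
  simp only [curvatureField, map_add]
  rw [cov_add _ ((g.vsmoothOn_leviCivita hu hW hV).vdiffAt hu hx)
    ((g.vsmoothOn_leviCivita hu hW hV').vdiffAt hu hx)]
  change _ - _ - g.leviCivita W x (mlieBracket (𝓡 n) U (V + V') x) = _
  rw [h1, map_add]
  abel

theorem curvatureField_add_right (hu : IsOpen u) (hx : x ∈ u)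
    {W' : Π x : M, TangentSpace (𝓡 n) x} (hU : VSmoothOn U u)
    (hV : VSmoothOn V u) (hW : VSmoothOn W u) (hW' : VSmoothOn W' u) :
    curvatureField g.leviCivita U V (fun y ↦ W y + W' y) x =
      curvatureField g.leviCivita U V W x + curvatureField g.leviCivita U V W' x := by
  have key : ∀ {U V : Π x : M, TangentSpace (𝓡 n) x}, VSmoothOn U u → VSmoothOn V u →
      g.leviCivita (fun y ↦ g.leviCivita (fun y ↦ W y + W' y) y (V y)) x (U x) =
      g.leviCivita (fun y ↦ g.leviCivita W y (V y)) x (U x) +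
      g.leviCivita (fun y ↦ g.leviCivita W' y (V y)) x (U x) := by
    intro U V hU hV
    rw [← cov_add _ ((g.vsmoothOn_leviCivita hu hW hV).vdiffAt hu hx)
      ((g.vsmoothOn_leviCivita hu hW' hV).vdiffAt hu hx)]
    congr 1
    refine cov_congr _ ((g.vsmoothOn_leviCivita hu (hW.add hW') hV).vdiffAt hu hx) ?_
    filter_upwards [hu.mem_nhds hx] with y hy
    exact cov_add _ (hW.vdiffAt hu hy) (hW'.vdiffAt hu hy) _
  simp only [curvatureField]
  rw [key hU hV, key hV hU, cov_add _ (hW.vdiffAt hu hx) (hW'.vdiffAt hu hx)]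
  abel

/-- First derivatives of `f` cancel in pairs, and the second ones combine to `U(Vf) - V(Uf) - [U,
V]f = 0`. -/
theorem curvatureField_smul_right (hu : IsOpen u) (hx : x ∈ u) (hU : VSmoothOn U u)
    (hV : VSmoothOn V u) (hW : VSmoothOn W u) (hf : SmoothOn (n := n) f u) :
    curvatureField g.leviCivita U V (fun y ↦ f y • W y) x =
      f x • curvatureField g.leviCivita U V W x := by
  have key : ∀ {U V : Π x : M, TangentSpace (𝓡 n) x}, VSmoothOn U u → VSmoothOn V u →
      g.leviCivita (fun y ↦ g.leviCivita (fun y ↦ f y • W y) y (V y)) x (U x) =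
      (f x • g.leviCivita (fun y ↦ g.leviCivita W y (V y)) x (U x) +
        mvfderiv (𝓡 n) f x (U x) • g.leviCivita W x (V x)) +
      (mvfderiv (𝓡 n) f x (V x) • g.leviCivita W x (U x) +
        mvfderiv (𝓡 n) (fun y ↦ mvfderiv (𝓡 n) f y (V y)) x (U x) • W x) := by
    intro U V hU hV
    have a := g.vsmoothOn_leviCivita hu hW hV
    have b := SmoothOn.mvfderiv hf hV hu
    rw [← cov_smul _ (SmoothOn.mdiffAt hf hu hx) (a.vdiffAt hu hx),
      ← cov_smul _ (SmoothOn.mdiffAt b hu hx) (hW.vdiffAt hu hx),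
      ← cov_add _ ((VSmoothOn.smul hf a).vdiffAt hu hx) ((VSmoothOn.smul b hW).vdiffAt hu hx)]
    congr 1
    refine cov_congr _ ((g.vsmoothOn_leviCivita hu (hW.smul hf) hV).vdiffAt hu hx) ?_
    filter_upwards [hu.mem_nhds hx] with y hy
    exact cov_smul _ (SmoothOn.mdiffAt hf hu hy) (hW.vdiffAt hu hy) _
  simp only [curvatureField]
  rw [key hU hV, key hV hU, cov_smul _ (SmoothOn.mdiffAt hf hu hx) (hW.vdiffAt hu hx),
    mvfderiv_mlieBracket hu hx hf hU hV]
  module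

theorem curvatureField_congr_right (hu : IsOpen u) (hx : x ∈ u)
    {W' : Π x : M, TangentSpace (𝓡 n) x} (hU : VSmoothOn U u)
    (hV : VSmoothOn V u) (hW : VSmoothOn W u) (h : ∀ y ∈ u, W y = W' y) :
    curvatureField g.leviCivita U V W x = curvatureField g.leviCivita U V W' x := by
  have e : ∀ y ∈ u, g.leviCivita W y = g.leviCivita W' y := fun y hy ↦
    cov_congr _ (hW.vdiffAt hu hy) (Filter.eventuallyEq_of_mem (hu.mem_nhds hy) h)
  have key : ∀ {V : Π x : M, TangentSpace (𝓡 n) x}, VSmoothOn V u →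
      g.leviCivita (fun y ↦ g.leviCivita W y (V y)) x =
      g.leviCivita (fun y ↦ g.leviCivita W' y (V y)) x := fun hV ↦
    cov_congr _ ((g.vsmoothOn_leviCivita hu hW hV).vdiffAt hu hx)
      (Filter.eventuallyEq_of_mem (hu.mem_nhds hx) fun y hy ↦ by rw [e y hy])
  simp only [curvatureField]
  rw [key hU, key hV, e x hx]

theorem curvatureField_sum_mid (hu : IsOpen u) (hx : x ∈ u)
    (hW : VSmoothOn W u) {ι : Type*} (s : Finset ι) {a : ι → M → ℝ}
    {V : ι → Π x : M, TangentSpace (𝓡 n) x} (ha : ∀ i, SmoothOn (n := n) (a i) u)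
    (hV : ∀ i, VSmoothOn (V i) u) :
    curvatureField g.leviCivita U (fun y ↦ ∑ i ∈ s, a i y • V i y) W x =
      ∑ i ∈ s, a i x • curvatureField g.leviCivita U (V i) W x := by
  classical
  induction s using Finset.induction_on with
  | empty =>
    have h := g.curvatureField_smul_mid hu hx (U := U) (V := fun y ↦ (0 : TangentSpace (𝓡 n) y))
      (contMDiff_zeroSection ℝ (TangentSpace (𝓡 n) : M → Type _)).contMDiffOn hW
      (f := fun _ ↦ (0 : ℝ)) contMDiffOn_const
    simpa using h
  | insert k s hk ih =>
    simp only [Finset.sum_insert hk]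
    rw [g.curvatureField_add_mid hu hx ((hV k).smul (ha k)) (VSmoothOn.sum fun i ↦ (hV i).smul (ha i))
      hW, ih, g.curvatureField_smul_mid hu hx (hV k) hW (ha k)]

theorem curvatureField_sum_right (hu : IsOpen u) (hx : x ∈ u) (hU : VSmoothOn U u)
    (hV : VSmoothOn V u) {ι : Type*} (s : Finset ι) {a : ι → M → ℝ}
    {W : ι → Π x : M, TangentSpace (𝓡 n) x} (ha : ∀ i, SmoothOn (n := n) (a i) u)
    (hW : ∀ i, VSmoothOn (W i) u) :
    curvatureField g.leviCivita U V (fun y ↦ ∑ i ∈ s, a i y • W i y) x =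
      ∑ i ∈ s, a i x • curvatureField g.leviCivita U V (W i) x := by
  classical
  induction s using Finset.induction_on with
  | empty =>
    have h := g.curvatureField_smul_right hu hx hU hV (W := fun y ↦ (0 : TangentSpace (𝓡 n) y))
      (contMDiff_zeroSection ℝ (TangentSpace (𝓡 n) : M → Type _)).contMDiffOn
      (f := fun _ ↦ (0 : ℝ)) contMDiffOn_const
    simpa using h
  | insert k s hk ih =>
    simp only [Finset.sum_insert hk]
    rw [g.curvatureField_add_right hu hx hU hV ((hW k).smul (ha k))
      (VSmoothOn.sum fun i ↦ (hW i).smul (ha i)), ih,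
      g.curvatureField_smul_right hu hx hU hV (hW k) (ha k)]

theorem curvatureField_congr_mid (hx : u ∈ 𝓝 x) {V' : Π x : M, TangentSpace (𝓡 n) x}
    (hu : IsOpen u) (hV : VSmoothOn V u) (hW : VSmoothOn W u) (h : ∀ y ∈ u, V y = V' y) :
    curvatureField g.leviCivita U V W x = curvatureField g.leviCivita U V' W x := by
  have hxu := mem_of_mem_nhds hx
  have e : V =ᶠ[𝓝 x] V' := Filter.eventuallyEq_of_mem hx h
  simp only [curvatureField]
  rw [(Filter.EventuallyEq.refl _ U).mlieBracket_vectorField_eq e, h x hxu,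
    cov_congr _ (W := fun y ↦ g.leviCivita W y (V' y))
      ((g.vsmoothOn_leviCivita hu hW hV).vdiffAt hu hxu)
      (e.mono fun y hy ↦ congrArg (g.leviCivita W y) hy)]

/-- The Ricci tensor of the Levi-Civita connection as a trace over the coordinate frame. -/
theorem ricci_leviCivita_apply (hV : VSmoothOn V univ) (hW : VSmoothOn W univ) :
    ricci g.leviCivita x (V x) (W x) =
      ∑ i, coord x i (curvatureField g.leviCivita (frame x i) V W x) := by
  set u := (chartAt (EuclideanSpace ℝ (Fin n)) x).source
  have hu : IsOpen u := (chartAt _ x).open_source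
  have hx : x ∈ u := mem_chart_source _ x
  have hE : ∀ i, VSmoothOn (frame x i) u := vsmoothOn_frame x
  replace hV : VSmoothOn V u := hV.mono (subset_univ u)
  replace hW : VSmoothOn W u := hW.mono (subset_univ u)
  have hcV : ∀ i, SmoothOn (n := n) (fun y ↦ coframe x i y (V y)) u :=
    (vsmoothOn_iff_coframe x hu subset_rfl).1 hV
  have hcW : ∀ i, SmoothOn (n := n) (fun y ↦ coframe x i y (W y)) u :=
    (vsmoothOn_iff_coframe x hu subset_rfl).1 hW
  have key : ∀ i, curvatureField g.leviCivita (frame x i) V W x =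
      ∑ j, ∑ k, (coord x j (V x) * coord x k (W x)) •
        curvatureField g.leviCivita (frame x i) (frame x j) (frame x k) x := by
    intro i
    -- The fields are expanded in the frame, first in the third slot and then in the second. The
    -- slot being traced holds a frame field throughout, so tensoriality in it is never needed.
    rw [g.curvatureField_congr_right hu hx (hE i) hV hW
        (fun y hy ↦ (sum_coframe_smul_frame x hy (W y)).symm),
      g.curvatureField_sum_right hu hx (hE i) hV _ hcW hE, Finset.sum_comm]
    refine Finset.sum_congr rfl fun k _ ↦ ?_
    rw [g.curvatureField_congr_mid (hu.mem_nhds hx) hu hV (hE k)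
        (fun y hy ↦ (sum_coframe_smul_frame x hy (V y)).symm),
      g.curvatureField_sum_mid hu hx (hE k) _ hcV hE, Finset.smul_sum]
    refine Finset.sum_congr rfl fun j _ ↦ ?_
    simp only [coframe_self, smul_smul, mul_comm]
  simp only [key, map_sum, map_smul, smul_eq_mul]
  rw [Finset.sum_comm]
  simp only [ricci, sum_apply, ricciComponent, curvature_coordVec]
  refine Finset.sum_congr rfl fun j _ ↦ ?_
  rw [Finset.sum_comm]
  refine Finset.sum_congr rfl fun k _ ↦ ?_
  simp [Finset.mul_sum, mul_comm, mul_left_comm]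

end Curvature

/-! ### Metric traces and norms as traces of endomorphisms. -/

section Trace

variable {x : M}

theorem sum_coord_smul_coordVec (x : M) (v : TangentSpace (𝓡 n) x) :
    ∑ i, coord x i v • coordVec x i = v := by
  simpa only [coframe_self, frame_self] using sum_coframe_smul_frame x (mem_chart_source _ x) v

theorem coord_coordVec (x : M) (i j : Fin n) :
    coord x i (coordVec x j) = if i = j then 1 else 0 := by
  simpa only [coframe_self, frame_self] using coframe_frame x i j (mem_chart_source _ x)

theorem sum_mul_coord (x : M) (φ : TangentSpace (𝓡 n) x →L[ℝ] ℝ) (v : TangentSpace (𝓡 n) x) :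
    ∑ i, φ (coordVec x i) * coord x i v = φ v := by
  conv_rhs => rw [← sum_coord_smul_coordVec x v, map_sum]
  simp [mul_comm]

theorem trace_eq_sum_coframe (p : M) {y : M}
    (hy : y ∈ (chartAt (EuclideanSpace ℝ (Fin n)) p).source)
    (L : TangentSpace (𝓡 n) y →L[ℝ] TangentSpace (𝓡 n) y) :
    LinearMap.trace ℝ (TangentSpace (𝓡 n) y) L = ∑ i, coframe p i y (L (frame p i y)) := by
  have h : (L : TangentSpace (𝓡 n) y →ₗ[ℝ] TangentSpace (𝓡 n) y) =
      ∑ i, (coframe p i y : TangentSpace (𝓡 n) y →ₗ[ℝ] ℝ).smulRight (L (frame p i y)) := by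
    ext v
    conv_lhs => rw [← sum_coframe_smul_frame p hy v]
    simp [LinearMap.sum_apply]
  rw [h, map_sum]
  simp

theorem trace_eq_sum_coord (x : M) (L : TangentSpace (𝓡 n) x →L[ℝ] TangentSpace (𝓡 n) x) :
    LinearMap.trace ℝ (TangentSpace (𝓡 n) x) L = ∑ i, coord x i (L (coordVec x i)) := by
  simpa only [coframe_self, frame_self] using trace_eq_sum_coframe x (mem_chart_source _ x) L

theorem bilin_ext_coordVec {B B' : TangentSpace (𝓡 n) x →L[ℝ] TangentSpace (𝓡 n) x →L[ℝ] ℝ}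
    (h : ∀ j k, B (coordVec x j) (coordVec x k) = B' (coordVec x j) (coordVec x k)) : B = B' := by
  ext v w
  rw [← sum_coord_smul_coordVec x v, ← sum_coord_smul_coordVec x w]
  simp only [map_sum, map_smul, sum_apply, smul_apply, h]

theorem ricci_coordVec (cov : CovariantDerivative (𝓡 n) (EuclideanSpace ℝ (Fin n))
    (TangentSpace (𝓡 n) : M → Type _)) (x : M) (j k : Fin n) :
    ricci cov x (coordVec x j) (coordVec x k) = ricciComponent cov x j k := by
  simp [ricci, sum_apply, coord_coordVec]

/-- Raising an index: `g^{ij} v_j = v^i`. This turns traces written with `invGram` into traces of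
endomorphisms. -/
theorem sum_invGram_mul_inner (x : M) (i : Fin n) (v : TangentSpace (𝓡 n) x) :
    ∑ j, g.invGram x i j * g.inner x v (coordVec x j) = coord x i v := by
  have h : g.invGram x * g.gram x = 1 := Matrix.nonsing_inv_mul _ (g.isUnit_det_gram x)
  have h2 : ∀ k, ∑ j, g.invGram x i j * g.inner x (coordVec x k) (coordVec x j) =
      if i = k then 1 else 0 := by
    intro k
    rw [← Matrix.one_apply, ← h, Matrix.mul_apply]
    exact Finset.sum_congr rfl fun j _ ↦ by rw [g.symm x]; rfl
  conv_lhs => rw [← sum_coord_smul_coordVec x v]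
  simp only [map_sum, map_smul, sum_apply, smul_apply, smul_eq_mul, Finset.mul_sum]
  rw [Finset.sum_comm]
  have h3 : ∀ k, ∑ j, g.invGram x i j * (coord x k v * g.inner x (coordVec x k) (coordVec x j)) =
      coord x k v * if i = k then 1 else 0 := by
    intro k
    rw [← h2 k, Finset.mul_sum]
    exact Finset.sum_congr rfl fun j _ ↦ by ring
  simp [h3]

theorem trace_add (B B' : TangentSpace (𝓡 n) x →L[ℝ] TangentSpace (𝓡 n) x →L[ℝ] ℝ) :
    g.trace x (B + B') = g.trace x B + g.trace x B' := by
  simp [trace, mul_add, Finset.sum_add_distrib]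

theorem trace_smul (a : ℝ) (B : TangentSpace (𝓡 n) x →L[ℝ] TangentSpace (𝓡 n) x →L[ℝ] ℝ) :
    g.trace x (a • B) = a * g.trace x B := by
  simp [trace, Finset.mul_sum, mul_left_comm]

theorem trace_inner_comp (L : TangentSpace (𝓡 n) x →L[ℝ] TangentSpace (𝓡 n) x) :
    g.trace x (g.inner x ∘L L) = LinearMap.trace ℝ (TangentSpace (𝓡 n) x) L := by
  simp only [trace, trace_eq_sum_coord, ContinuousLinearMap.comp_apply, sum_invGram_mul_inner]

theorem trace_inner (x : M) : g.trace x (g.inner x) = n := by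
  have h := g.trace_inner_comp (ContinuousLinearMap.id ℝ (TangentSpace (𝓡 n) x))
  rw [ContinuousLinearMap.comp_id] at h
  rw [h, trace_eq_sum_coord]
  simp [coord_coordVec]

/-- The square norm of `g(L ·, ·)` for a self-adjoint endomorphism `L` is the trace of `L²`. -/
theorem normSqTensor_inner_comp {L : TangentSpace (𝓡 n) x →L[ℝ] TangentSpace (𝓡 n) x}
    (hL : ∀ v w, g.inner x (L v) w = g.inner x (L w) v) :
    g.normSqTensor x (g.inner x ∘L L) = LinearMap.trace ℝ (TangentSpace (𝓡 n) x) (L ∘L L) := by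
  have hs : ∀ i j, g.invGram x i j = g.invGram x j i := by
    intro i j
    have h : (g.gram x).transpose = g.gram x := by
      ext a b
      exact g.symm x _ _
    have h2 : (g.invGram x).transpose = g.invGram x := by
      rw [invGram, Matrix.transpose_nonsing_inv, h]
    rw [← Matrix.transpose_apply (g.invGram x) j i, h2]
  -- The sum over `l` raises an index. The sum over `j` then produces `g(L e_i, L e_k)`, which
  -- self-adjointness turns into `g(L(L e_k), e_i)`; raising the index `i` yields the trace.
  have h1 : ∀ i j k, ∑ l, g.invGram x i k * g.invGram x j l *
      g.inner x (L (coordVec x i)) (coordVec x j) * g.inner x (L (coordVec x k)) (coordVec x l) =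
      g.invGram x i k * (g.inner x (L (coordVec x i)) (coordVec x j) *
        coord x j (L (coordVec x k))) := by
    intro i j k
    rw [← g.sum_invGram_mul_inner x j, Finset.mul_sum, Finset.mul_sum]
    exact Finset.sum_congr rfl fun l _ ↦ by ring
  simp only [normSqTensor, trace_eq_sum_coord, ContinuousLinearMap.comp_apply, h1]
  have h2 : ∀ i, ∑ j, ∑ k, g.invGram x i k * (g.inner x (L (coordVec x i)) (coordVec x j) *
      coord x j (L (coordVec x k))) =
      ∑ k, g.invGram x k i * g.inner x (L (L (coordVec x k))) (coordVec x i) := by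
    intro i
    rw [Finset.sum_comm]
    refine Finset.sum_congr rfl fun k _ ↦ ?_
    rw [← Finset.mul_sum, sum_mul_coord x (g.inner x (L (coordVec x i))), hs, hL (coordVec x i)]
  simp only [h2]
  rw [Finset.sum_comm]
  simp only [sum_invGram_mul_inner]

end Trace

/-! ### The Laplacian and Bochner's formula. -/

section Gradient

theorem mvfderiv_congr {a b : M → ℝ} {x : M} (h : a =ᶠ[𝓝 x] b) :
    mvfderiv (𝓡 n) a x = mvfderiv (𝓡 n) b x := by
  ext v
  exact congrArg (fun L : TangentSpace (𝓡 n) x →L[ℝ] ℝ ↦ L v) h.mfderiv_eq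

theorem mvfderiv_sum {ι : Type} (s : Finset ι) {a : ι → M → ℝ} {x : M}
    (ha : ∀ i, MDifferentiableAt (𝓡 n) 𝓘(ℝ, ℝ) (a i) x) (v : TangentSpace (𝓡 n) x) :
    mvfderiv (𝓡 n) (fun y ↦ ∑ i ∈ s, a i y) x v = ∑ i ∈ s, mvfderiv (𝓡 n) (a i) x v := by
  classical
  induction s using Finset.induction_on with
  | empty => simp [mvfderiv_const]
  | insert k s hk ih =>
    simp only [Finset.sum_insert hk]
    have h : MDifferentiableAt (𝓡 n) 𝓘(ℝ, ℝ) (fun y ↦ ∑ i ∈ s, a i y) x := by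
      have h := MDifferentiableAt.sum (t := s) (f := a) (z := x) (fun (i : ι) (_ : i ∈ s) ↦ ha i)
      rwa [Finset.sum_fn] at h
    rw [← ih, mvfderiv_fun_add (ha k) h]
    rfl

variable {f : M → ℝ} {c : ℝ} {x : M}

/-- The Laplacian of a function, the trace of the covariant derivative of its gradient. -/
def laplacian (f : M → ℝ) (x : M) : ℝ :=
  LinearMap.trace ℝ (TangentSpace (𝓡 n) x) (g.leviCivita (g.grad f) x)

theorem trace_hessian (f : M → ℝ) (x : M) :
    g.trace x (g.hessian g.leviCivita f x) = g.laplacian f x :=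
  g.trace_inner_comp _

/-- A field of endomorphisms preserving smoothness of vector fields has a smooth trace. -/
theorem contMDiff_trace {L : Π y : M, TangentSpace (𝓡 n) y →L[ℝ] TangentSpace (𝓡 n) y}
    (hL : ∀ (u : Set M) (V : Π y : M, TangentSpace (𝓡 n) y), IsOpen u → VSmoothOn V u →
      VSmoothOn (fun y ↦ L y (V y)) u) :
    ContMDiff (𝓡 n) 𝓘(ℝ, ℝ) ∞ (fun y ↦ LinearMap.trace ℝ (TangentSpace (𝓡 n) y) (L y)) := by
  intro p
  set u := (chartAt (EuclideanSpace ℝ (Fin n)) p).source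
  have hu : IsOpen u := (chartAt _ p).open_source
  have hp : p ∈ u := mem_chart_source _ p
  have h : SmoothOn (n := n) (fun y ↦ ∑ i, coframe p i y (L y (frame p i y))) u :=
    contMDiffOn_finsetSum fun i _ ↦
      (vsmoothOn_iff_coframe p hu subset_rfl).1 (hL u _ hu (vsmoothOn_frame p i)) i
  exact (h.congr fun y hy ↦ trace_eq_sum_coframe p hy (L y)).contMDiffAt (hu.mem_nhds hp)

theorem vsmoothOn_grad_of_contMDiff (hf : ContMDiff (𝓡 n) 𝓘(ℝ, ℝ) ∞ f) (u : Set M) :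
    VSmoothOn (g.grad f) u :=
  (g.vsmoothOn_grad isOpen_univ hf.contMDiffOn).mono (subset_univ u)

theorem contMDiff_laplacian (hf : ContMDiff (𝓡 n) 𝓘(ℝ, ℝ) ∞ f) :
    ContMDiff (𝓡 n) 𝓘(ℝ, ℝ) ∞ (g.laplacian f) :=
  contMDiff_trace fun u _ hu hV ↦
    g.vsmoothOn_leviCivita hu (g.vsmoothOn_grad_of_contMDiff hf u) hV

/-- Symmetry of the Hessian makes `∇ξ` self-adjoint, so its square norm is `tr (∇ξ)²`, the form in
which it appears in Bochner's formula. In indefinite signature it may be negative. -/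
theorem normSqTensor_hessian (hf : ContMDiff (𝓡 n) 𝓘(ℝ, ℝ) ∞ f) (x : M) :
    g.normSqTensor x (g.hessian g.leviCivita f x) = LinearMap.trace ℝ (TangentSpace (𝓡 n) x)
      (g.leviCivita (g.grad f) x ∘L g.leviCivita (g.grad f) x) :=
  g.normSqTensor_inner_comp (g.inner_leviCivita_grad_comm hf)

theorem contMDiff_normSqTensor_hessian (hf : ContMDiff (𝓡 n) 𝓘(ℝ, ℝ) ∞ f) :
    ContMDiff (𝓡 n) 𝓘(ℝ, ℝ) ∞ (fun x ↦ g.normSqTensor x (g.hessian g.leviCivita f x)) := by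
  simp only [g.normSqTensor_hessian hf]
  exact contMDiff_trace fun u _ hu hV ↦
    g.vsmoothOn_leviCivita hu (g.vsmoothOn_grad_of_contMDiff hf u)
      (g.vsmoothOn_leviCivita hu (g.vsmoothOn_grad_of_contMDiff hf u) hV)

/-- Bochner's formula for a function whose gradient has constant square norm. -/
theorem ricci_grad_grad (hf : ContMDiff (𝓡 n) 𝓘(ℝ, ℝ) ∞ f) (hc : ∀ x, g.normSqGrad f x = c)
    (x : M) :
    ricci g.leviCivita x (g.grad f x) (g.grad f x) =
      - mvfderiv (𝓡 n) (g.laplacian f) x (g.grad f x)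
        - g.normSqTensor x (g.hessian g.leviCivita f x) := by
  set u := (chartAt (EuclideanSpace ℝ (Fin n)) x).source
  have hu : IsOpen u := (chartAt _ x).open_source
  have hx : x ∈ u := mem_chart_source _ x
  have hE : ∀ i, VSmoothOn (frame x i) u := vsmoothOn_frame x
  have hξ : VSmoothOn (g.grad f) u := g.vsmoothOn_grad_of_contMDiff hf u
  set ξ := g.grad f with hξdef
  set D := g.leviCivita with hD
  let a (i j : Fin n) (y : M) : ℝ := coframe x j y (D ξ y (frame x i y))
  have hTE : ∀ i, VSmoothOn (fun y ↦ D ξ y (frame x i y)) u := fun i ↦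
    g.vsmoothOn_leviCivita hu hξ (hE i)
  have ha : ∀ i j, SmoothOn (n := n) (a i j) u := fun i j ↦
    (vsmoothOn_iff_coframe x hu subset_rfl).1 (hTE i) j
  -- Since `∇_ξ ξ = 0` identically, `R(E_i, ξ)ξ = -∇_ξ ∇_{E_i} ξ - ∇_{[E_i, ξ]} ξ`.
  have hzero : (fun y ↦ D ξ y (ξ y)) = fun y ↦ (0 : TangentSpace (𝓡 n) y) :=
    funext fun y ↦ g.leviCivita_grad_grad hf hc
  have hDT : ∀ i, D (fun y ↦ D ξ y (frame x i y)) x (ξ x) =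
      ∑ j, (a i j x • D (frame x j) x (ξ x) + mvfderiv (𝓡 n) (a i j) x (ξ x) • coordVec x j) := by
    intro i
    rw [cov_congr D (W := fun y ↦ ∑ j, a i j y • frame x j y) ((hTE i).vdiffAt hu hx)
      (Filter.eventuallyEq_of_mem (hu.mem_nhds hx) fun y hy ↦
        (sum_coframe_smul_frame x hy _).symm),
      cov_sum D _ fun j ↦ ((hE j).smul (ha i j)).vdiffAt hu hx]
    refine Finset.sum_congr rfl fun j _ ↦ ?_
    rw [cov_smul D (SmoothOn.mdiffAt (ha i j) hu hx) ((hE j).vdiffAt hu hx), frame_self]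
  have hcurv : ∀ i, curvatureField D (frame x i) ξ ξ x =
      - ∑ j, (a i j x • D (frame x j) x (ξ x) + mvfderiv (𝓡 n) (a i j) x (ξ x) • coordVec x j)
      - D ξ x (D ξ x (coordVec x i)) + D ξ x (D (frame x i) x (ξ x)) := by
    intro i
    simp only [curvatureField]
    rw [hzero, cov_zero, hDT, g.mlieBracket_eq_leviCivita ((hE i).vdiffAt hu hx)
      (hξ.vdiffAt hu hx), map_sub, frame_self]
    abel
  have hlap : mvfderiv (𝓡 n) (g.laplacian f) x (ξ x) = ∑ i, mvfderiv (𝓡 n) (a i i) x (ξ x) := by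
    have h1 : g.laplacian f =ᶠ[𝓝 x] fun y ↦ ∑ i, a i i y :=
      Filter.eventuallyEq_of_mem (hu.mem_nhds hx) fun y hy ↦ trace_eq_sum_coframe x hy _
    rw [mvfderiv_congr h1, mvfderiv_sum _ fun i ↦ SmoothOn.mdiffAt (ha i i) hu hx]
  have hexp : ∀ i, coord x i (D ξ x (D (frame x i) x (ξ x))) =
      ∑ j, a j i x * coord x j (D (frame x i) x (ξ x)) := by
    intro i
    refine (sum_mul_coord x (coord x i ∘L D ξ x) _).symm.trans ?_
    refine Finset.sum_congr rfl fun j _ ↦ ?_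
    simp only [a, coframe_self, frame_self, ContinuousLinearMap.comp_apply]
  -- The terms with `∇_ξ E_j` form the trace of a commutator of two matrices, that of `∇ξ` and that
  -- of `∇_ξ` acting on the frame, so they cancel.
  have hcancel : ∑ i, ∑ j, a i j x * coord x i (D (frame x j) x (ξ x)) =
      ∑ i, ∑ j, a j i x * coord x j (D (frame x i) x (ξ x)) := Finset.sum_comm
  have hξu : VSmoothOn ξ univ := g.vsmoothOn_grad_of_contMDiff hf univ
  rw [g.ricci_leviCivita_apply hξu hξu, g.normSqTensor_hessian hf, trace_eq_sum_coord, hlap]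
  simp only [← hD, hcurv, map_add, map_sub, map_neg, map_sum, map_smul, smul_eq_mul,
    coord_coordVec, hexp, Finset.sum_add_distrib, Finset.sum_sub_distrib, Finset.sum_neg_distrib,
    hcancel, ContinuousLinearMap.comp_apply, mul_ite, mul_one, mul_zero, Finset.sum_ite_eq,
    Finset.mem_univ, if_true, ← hξdef]
  ring

end Gradient

/-! ### Curvature and Ricci tensor of the connection defined by `df`. -/

section DifferentialConnection

variable {f : M → ℝ} {c : ℝ} {x : M} {u : Set M} {U V W : Π x : M, TangentSpace (𝓡 n) x}

/-- The difference tensor `A(v, w) = df(v) w + df(w) v + g(v, w) grad f` of the connection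
defined by `df` and the Levi-Civita connection. -/
def gradTensor (f : M → ℝ) (x : M) (v w : TangentSpace (𝓡 n) x) : TangentSpace (𝓡 n) x :=
  g.inner x (g.grad f x) v • w + g.inner x (g.grad f x) w • v + g.inner x v w • g.grad f x

theorem oneFormConnection_mvfderiv_apply (f : M → ℝ) (W : Π x : M, TangentSpace (𝓡 n) x) (x : M)
    (v : TangentSpace (𝓡 n) x) :
    g.oneFormConnection (mvfderiv (𝓡 n) f) W x v =
      g.leviCivita W x v + g.gradTensor f x v (W x) := by
  rw [oneFormConnection_apply, gradTensor, inner_grad, inner_grad]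
  rfl

theorem vsmoothOn_gradTensor (hf : ContMDiff (𝓡 n) 𝓘(ℝ, ℝ) ∞ f) (hV : VSmoothOn V u)
    (hW : VSmoothOn W u) : VSmoothOn (fun y ↦ g.gradTensor f y (V y) (W y)) u := by
  have hξ := g.vsmoothOn_grad_of_contMDiff hf u
  exact ((hW.smul (g.smoothOn_inner hξ hV)).add (hV.smul (g.smoothOn_inner hξ hW))).add
    (hξ.smul (g.smoothOn_inner hV hW))

/-- Product rule: as `∇g = 0`, only the derivative of `grad f` contributes to `∇A`, once in each of
the three terms of `A`. -/
theorem leviCivita_gradTensor (hf : ContMDiff (𝓡 n) 𝓘(ℝ, ℝ) ∞ f) (hu : IsOpen u) (hx : x ∈ u)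
    (hV : VSmoothOn V u) (hW : VSmoothOn W u) (v : TangentSpace (𝓡 n) x) :
    g.leviCivita (fun y ↦ g.gradTensor f y (V y) (W y)) x v =
      g.gradTensor f x (g.leviCivita V x v) (W x) + g.gradTensor f x (V x) (g.leviCivita W x v)
      + g.inner x (g.leviCivita (g.grad f) x v) (V x) • W x
      + g.inner x (g.leviCivita (g.grad f) x v) (W x) • V x
      + g.inner x (V x) (W x) • g.leviCivita (g.grad f) x v := by
  have hξ := g.vsmoothOn_grad_of_contMDiff hf u
  have a1 := g.smoothOn_inner hξ hV
  have a2 := g.smoothOn_inner hξ hW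
  have a3 := g.smoothOn_inner hV hW
  have dV := hV.vdiffAt hu hx
  have dW := hW.vdiffAt hu hx
  have dξ := hξ.vdiffAt hu hx
  simp only [gradTensor]
  rw [cov_add _ (((hW.smul a1).add (hV.smul a2)).vdiffAt hu hx) ((hξ.smul a3).vdiffAt hu hx),
    cov_add _ ((hW.smul a1).vdiffAt hu hx) ((hV.smul a2).vdiffAt hu hx),
    cov_smul _ (SmoothOn.mdiffAt a1 hu hx) dW, cov_smul _ (SmoothOn.mdiffAt a2 hu hx) dV,
    cov_smul _ (SmoothOn.mdiffAt a3 hu hx) dξ, g.mvfderiv_inner dξ dV, g.mvfderiv_inner dξ dW,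
    g.mvfderiv_inner dV dW]
  module

/-- For `∇ + A` the curvature changes by `(∇_U A)(V, W) - (∇_V A)(U, W) + A(U, A(V, W)) - A(V, A(U,
W))`, zero torsion absorbing the term `A([U, V], W)`. The two multiples of `W` in the
antisymmetrized `∇A` cancel by symmetry of the Hessian. -/
theorem curvatureField_oneFormConnection (hf : ContMDiff (𝓡 n) 𝓘(ℝ, ℝ) ∞ f) (hu : IsOpen u)
    (hx : x ∈ u) (hU : VSmoothOn U u) (hV : VSmoothOn V u) (hW : VSmoothOn W u) :
    curvatureField (g.oneFormConnection (mvfderiv (𝓡 n) f)) U V W x =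
      curvatureField g.leviCivita U V W x
      + g.inner x (g.leviCivita (g.grad f) x (U x)) (W x) • V x
      + g.inner x (V x) (W x) • g.leviCivita (g.grad f) x (U x)
      - g.inner x (g.leviCivita (g.grad f) x (V x)) (W x) • U x
      - g.inner x (U x) (W x) • g.leviCivita (g.grad f) x (V x)
      + g.gradTensor f x (U x) (g.gradTensor f x (V x) (W x))
      - g.gradTensor f x (V x) (g.gradTensor f x (U x) (W x)) := by
  have hUV := g.mlieBracket_eq_leviCivita (hU.vdiffAt hu hx) (hV.vdiffAt hu hx)
  have hsymm := g.inner_leviCivita_grad_comm hf (U x) (V x)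
  have key : ∀ {U V : Π x : M, TangentSpace (𝓡 n) x}, VSmoothOn U u → VSmoothOn V u →
      g.leviCivita (fun y ↦ g.leviCivita W y (V y) + g.gradTensor f y (V y) (W y)) x (U x) =
      g.leviCivita (fun y ↦ g.leviCivita W y (V y)) x (U x) +
      g.leviCivita (fun y ↦ g.gradTensor f y (V y) (W y)) x (U x) := fun hU hV ↦
    cov_add _ ((g.vsmoothOn_leviCivita hu hW hV).vdiffAt hu hx)
      ((g.vsmoothOn_gradTensor hf hV hW).vdiffAt hu hx) _
  simp only [curvatureField, oneFormConnection_mvfderiv_apply]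
  rw [key hU hV, key hV hU, g.leviCivita_gradTensor hf hu hx hV hW,
    g.leviCivita_gradTensor hf hu hx hU hW, hUV, hsymm]
  simp only [gradTensor, map_add, map_sub, map_smul, sub_apply, smul_eq_mul]
  module

theorem sum_coord_gradTensor (x : M) (z : TangentSpace (𝓡 n) x) :
    ∑ i, coord x i (g.gradTensor f x (coordVec x i) z) = (n + 2) * g.inner x (g.grad f x) z := by
  have s1 := sum_mul_coord x (g.inner x (g.grad f x)) z
  have s2 := sum_mul_coord x (g.inner x z) (g.grad f x)
  simp only [gradTensor, map_add, map_smul, smul_eq_mul, Finset.sum_add_distrib,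
    ← Finset.mul_sum, s1, g.symm x _ z, s2, coord_coordVec, if_true, Finset.sum_const,
    Finset.card_univ, Fintype.card_fin, nsmul_eq_mul]
  ring

theorem sum_coord_gradTensor_gradTensor (hc : ∀ x, g.normSqGrad f x = c) (x : M)
    (v w : TangentSpace (𝓡 n) x) :
    ∑ i, coord x i (g.gradTensor f x v (g.gradTensor f x (coordVec x i) w)) =
      (n + 6) * (g.inner x (g.grad f x) v * g.inner x (g.grad f x) w)
        + 2 * c * g.inner x v w := by
  have hcx : g.inner x (g.grad f x) (g.grad f x) = c := hc x
  -- The inner `A(e_i, w)` is expanded and the symmetry of `A` moves `e_i` to its first slot. The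
  -- traces are `df(A(v, w))`, `(n + 2) df(v) df(w)` and `g(w, A(v, ξ))`; the first and last
  -- contribute `2 df(v) df(w) + c g(v, w)` each.
  have e : ∀ i, coord x i (g.gradTensor f x v (g.gradTensor f x (coordVec x i) w)) =
      g.inner x (g.grad f x) (coordVec x i) * coord x i (g.gradTensor f x v w)
      + g.inner x (g.grad f x) w * coord x i (g.gradTensor f x (coordVec x i) v)
      + g.inner x w (coordVec x i) * coord x i (g.gradTensor f x v (g.grad f x)) := by
    intro i
    simp only [gradTensor, map_add, map_smul, smul_eq_mul]
    rw [g.symm x (coordVec x i) v, g.symm x (coordVec x i) w]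
    ring
  simp only [e, Finset.sum_add_distrib, ← Finset.mul_sum, sum_coord_gradTensor]
  rw [sum_mul_coord x (g.inner x (g.grad f x)), sum_mul_coord x (g.inner x w)]
  simp only [gradTensor, map_add, map_smul, smul_eq_mul]
  rw [g.symm x v (g.grad f x), g.symm x w (g.grad f x), g.symm x w v, hcx]
  ring

/-- The Ricci tensor of the connection defined by the differential of a function. -/
theorem ricci_oneFormConnection (hf : ContMDiff (𝓡 n) 𝓘(ℝ, ℝ) ∞ f)
    (hc : ∀ x, g.normSqGrad f x = c) (x : M) :
    ricci (g.oneFormConnection (mvfderiv (𝓡 n) f)) x =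
      ricci g.leviCivita x + (g.laplacian f x + n * c) • g.inner x
      + (-n : ℝ) • g.hessian g.leviCivita f x
      + (n - 2 : ℝ) • (mvfderiv (𝓡 n) f x).smulRight (mvfderiv (𝓡 n) f x) := by
  refine bilin_ext_coordVec fun j k ↦ ?_
  have hu : IsOpen (chartAt (EuclideanSpace ℝ (Fin n)) x).source := (chartAt _ x).open_source
  have hx := mem_chart_source (EuclideanSpace ℝ (Fin n)) x
  have hE := vsmoothOn_frame (n := n) x
  have hcx : g.inner x (g.grad f x) (g.grad f x) = c := hc x
  have hcurv : ∀ i, coord x i (curvature (g.oneFormConnection (mvfderiv (𝓡 n) f)) x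
        (coordVec x i) (coordVec x j) (coordVec x k)) =
      coord x i (curvature g.leviCivita x (coordVec x i) (coordVec x j) (coordVec x k))
      + g.inner x (g.leviCivita (g.grad f) x (coordVec x k)) (coordVec x i)
        * coord x i (coordVec x j)
      + g.inner x (coordVec x j) (coordVec x k)
        * coord x i (g.leviCivita (g.grad f) x (coordVec x i))
      - g.inner x (g.leviCivita (g.grad f) x (coordVec x j)) (coordVec x k)
        * coord x i (coordVec x i)
      - g.inner x (coordVec x k) (coordVec x i)
        * coord x i (g.leviCivita (g.grad f) x (coordVec x j))
      + coord x i (g.gradTensor f x (coordVec x i)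
          (g.gradTensor f x (coordVec x j) (coordVec x k)))
      - coord x i (g.gradTensor f x (coordVec x j)
          (g.gradTensor f x (coordVec x i) (coordVec x k))) := by
    intro i
    rw [curvature_coordVec, curvature_coordVec, g.curvatureField_oneFormConnection hf hu hx (hE _)
      (hE _) (hE _), g.inner_leviCivita_grad_comm hf (coordVec x k), g.symm x (coordVec x k)]
    simp only [map_add, map_sub, map_smul, smul_eq_mul, frame_self]
  have hlap := trace_eq_sum_coord x (g.leviCivita (g.grad f) x)
  rw [ricci_coordVec, ricciComponent, Finset.sum_congr rfl fun i _ ↦ hcurv i]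
  simp only [add_apply, smul_apply, smul_eq_mul, ricci_coordVec, hessian,
    ContinuousLinearMap.comp_apply, ContinuousLinearMap.smulRight_apply, Finset.sum_add_distrib,
    Finset.sum_sub_distrib, ← g.inner_grad, ← Finset.mul_sum]
  -- The Hessian terms have coefficients `1 - n - 1 = -n`. The quadratic ones are `(n + 2)(2 df ⊗ df
  -- + c g) - (n + 6) df ⊗ df - 2c g = (n - 2) df ⊗ df + nc g`.
  rw [sum_mul_coord x (g.inner x (g.leviCivita (g.grad f) x (coordVec x k))),
    sum_mul_coord x (g.inner x (coordVec x k)), sum_coord_gradTensor,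
    g.sum_coord_gradTensor_gradTensor hc, laplacian, hlap, ricciComponent,
    g.inner_leviCivita_grad_comm hf (coordVec x k), g.symm x (coordVec x k)]
  simp only [gradTensor, map_add, map_smul, smul_eq_mul, coord_coordVec, if_true, Finset.sum_const,
    Finset.card_univ, Fintype.card_fin, nsmul_eq_mul, hcx]
  ring

end DifferentialConnection

/-! ### Pointwise consequences of the soliton equations. -/

section Soliton

variable {f : M → ℝ} {c : ℝ} {x : M} {lam : M → ℝ}

theorem inner_grad_eq_mul (hc : ∀ x, g.normSqGrad f x = c) (x : M) :
    mvfderiv (𝓡 n) f x (g.grad f x) = c := by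
  rw [← inner_grad]; exact hc x

theorem trace_smulRight_mvfderiv (hc : ∀ x, g.normSqGrad f x = c) (x : M) :
    g.trace x ((mvfderiv (𝓡 n) f x).smulRight (mvfderiv (𝓡 n) f x)) = c := by
  have h : (mvfderiv (𝓡 n) f x).smulRight (mvfderiv (𝓡 n) f x) =
      g.inner x ∘L (mvfderiv (𝓡 n) f x).smulRight (g.grad f x) := by
    ext v w
    simp [inner_grad]
  rw [h, trace_inner_comp, trace_eq_sum_coord]
  simp only [ContinuousLinearMap.smulRight_apply, map_smul, smul_eq_mul]
  rw [sum_mul_coord x (mvfderiv (𝓡 n) f x), g.inner_grad_eq_mul hc]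

theorem hessian_grad_grad (hf : ContMDiff (𝓡 n) 𝓘(ℝ, ℝ) ∞ f) (hc : ∀ x, g.normSqGrad f x = c)
    (x : M) : g.hessian g.leviCivita f x (g.grad f x) (g.grad f x) = 0 :=
  g.inner_leviCivita_grad_self hf hc _

/-- The derivative of `scal` along `grad f` when `scal = a λ - b Δf - d`. -/
theorem mvfderiv_scal_of_eq (hf : ContMDiff (𝓡 n) 𝓘(ℝ, ℝ) ∞ f)
    (hlam : ContMDiff (𝓡 n) 𝓘(ℝ, ℝ) ∞ lam) {a d : ℝ}
    (h : ∀ x, g.scal g.leviCivita x = a * lam x - g.laplacian f x - d) (v : TangentSpace (𝓡 n) x) :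
    mvfderiv (𝓡 n) (g.scal g.leviCivita) x v =
      a * mvfderiv (𝓡 n) lam x v - mvfderiv (𝓡 n) (g.laplacian f) x v := by
  have h1 := (hlam x).mdifferentiableAt (by simp)
  have h2 := (g.contMDiff_laplacian hf x).mdifferentiableAt (by simp)
  have e : g.scal g.leviCivita = fun x ↦ a * lam x + ((-1) * g.laplacian f x + (-d)) := by
    funext y; rw [h]; ring
  have c1 : ∀ r : ℝ, MDifferentiableAt (𝓡 n) 𝓘(ℝ, ℝ) (fun _ : M ↦ r) x := fun _ ↦
    mdifferentiableAt_const
  have h3 : MDifferentiableAt (𝓡 n) 𝓘(ℝ, ℝ) (fun y ↦ a * lam y) x := (c1 a).mul h1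
  have h4 : MDifferentiableAt (𝓡 n) 𝓘(ℝ, ℝ) (fun y ↦ (-1) * g.laplacian f y) x := (c1 (-1)).mul h2
  have h5 : MDifferentiableAt (𝓡 n) 𝓘(ℝ, ℝ) (fun y ↦ (-1) * g.laplacian f y + (-d)) x :=
    h4.add (c1 (-d))
  rw [e, mvfderiv_fun_add h3 h5, mvfderiv_fun_add h4 (c1 (-d)), mvfderiv_fun_mul (c1 a) h1,
    mvfderiv_fun_mul (c1 (-1)) h2]
  simp [mvfderiv_const]
  ring

/-- The equation of an almost soliton as an equation between bilinear forms. -/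
theorem IsAlmostSoliton.hessian_add_ricci
    {cov cov' : CovariantDerivative (𝓡 n) (EuclideanSpace ℝ (Fin n))
      (TangentSpace (𝓡 n) : M → Type _)}
    (h : IsAlmostSoliton cov (g.ricciOperator cov') (g.grad f) lam) (x : M) :
    g.hessian cov f x + ricci cov' x = lam x • g.inner x := by
  ext v w
  have h1 := congrArg (fun L ↦ g.inner x (L v) w) (h.equation x)
  simpa only [add_apply, map_add, smul_apply, map_smul, inner_ricciOperator,
    ContinuousLinearMap.id_apply] using! h1

/-- The trace of the soliton equation. The terms `±n Δf` cancel, and the constant is `n · n` from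
`nc g` plus `n - 2` from `df ⊗ df`. -/
theorem scal_of_almostSoliton_leviCivita (hf : ContMDiff (𝓡 n) 𝓘(ℝ, ℝ) ∞ f)
    (hc : ∀ x, g.normSqGrad f x = c)
    (h : IsAlmostSoliton g.leviCivita
      (g.ricciOperator (g.oneFormConnection (mvfderiv (𝓡 n) f))) (g.grad f) lam) (y : M) :
    g.scal g.leviCivita y = n * lam y - g.laplacian f y - ((n : ℝ) ^ 2 + n - 2) * c := by
  have ht := congrArg (g.trace y) (IsAlmostSoliton.hessian_add_ricci g h y)
  simp only [g.ricci_oneFormConnection hf hc, trace_add, trace_smul, trace_hessian, trace_inner,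
    g.trace_smulRight_mvfderiv hc] at ht
  rw [scal]
  linarith

theorem hessian_oneFormConnection (hc : ∀ x, g.normSqGrad f x = c) (y : M) :
    g.hessian (g.oneFormConnection (mvfderiv (𝓡 n) f)) f y =
      g.hessian g.leviCivita f y + (2 : ℝ) • (mvfderiv (𝓡 n) f y).smulRight (mvfderiv (𝓡 n) f y)
      + c • g.inner y := by
  ext v w
  have hcy : g.inner y (g.grad f y) (g.grad f y) = c := hc y
  simp only [hessian, ContinuousLinearMap.comp_apply, oneFormConnection_mvfderiv_apply,
    gradTensor, map_add, map_smul, add_apply, smul_apply, smul_eq_mul, hcy,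
    ContinuousLinearMap.smulRight_apply, ← g.inner_grad, g.symm y v (g.grad f y)]
  ring

theorem scal_of_soliton_oneFormConnection (hc : ∀ x, g.normSqGrad f x = c)
    (h : IsAlmostSoliton (g.oneFormConnection (mvfderiv (𝓡 n) f))
      (g.ricciOperator g.leviCivita) (g.grad f) lam) (y : M) :
    g.scal g.leviCivita y = n * lam y - g.laplacian f y - (2 + n) * c := by
  have ht := congrArg (g.trace y) (IsAlmostSoliton.hessian_add_ricci g h y)
  simp only [g.hessian_oneFormConnection hc, trace_add, trace_smul, trace_hessian, trace_inner,
    g.trace_smulRight_mvfderiv hc] at ht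
  rw [scal]
  linarith

/-- Smoothness of `scal`, needed to integrate its derivative, is read off from the traced soliton
equation. -/
theorem contMDiff_scal_of_eq (hf : ContMDiff (𝓡 n) 𝓘(ℝ, ℝ) ∞ f)
    (hlam : ContMDiff (𝓡 n) 𝓘(ℝ, ℝ) ∞ lam) {a d : ℝ}
    (h : ∀ x, g.scal g.leviCivita x = a * lam x - g.laplacian f x - d) :
    ContMDiff (𝓡 n) 𝓘(ℝ, ℝ) ∞ (g.scal g.leviCivita) :=
  (((contMDiff_const.mul hlam).sub (g.contMDiff_laplacian hf)).sub contMDiff_const).congr h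

/-- The pointwise identity behind the volume formula for the almost solitons
`(∇^g, Q^{df}, grad f, λ)`. -/
theorem almostSoliton_leviCivita_identity (hf : ContMDiff (𝓡 n) 𝓘(ℝ, ℝ) ∞ f)
    (hc : ∀ x, g.normSqGrad f x = c)
    (h : IsAlmostSoliton g.leviCivita
      (g.ricciOperator (g.oneFormConnection (mvfderiv (𝓡 n) f))) (g.grad f) lam) (x : M) :
    2 * ((n : ℝ) - 1) * c ^ 2 = g.normSqTensor x (g.hessian g.leviCivita f x)
      + c * lam x + n * mvfderiv (𝓡 n) lam x (g.grad f x)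
      - mvfderiv (𝓡 n) (g.scal g.leviCivita) x (g.grad f x) - c * g.laplacian f x := by
  have eqn := IsAlmostSoliton.hessian_add_ricci g h
  simp only [g.ricci_oneFormConnection hf hc] at eqn
  have hd := g.mvfderiv_scal_of_eq hf h.contMDiff (g.scal_of_almostSoliton_leviCivita hf hc h)
    (g.grad f x)
  have hb := g.ricci_grad_grad hf hc x
  have hξ := congrArg (fun B ↦ B (g.grad f x) (g.grad f x)) (eqn x)
  simp only [add_apply, smul_apply, g.hessian_grad_grad hf hc, smul_eq_mul,
    ContinuousLinearMap.smulRight_apply, g.inner_grad_eq_mul hc, g.inner_grad] at hξ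
  rw [hd]
  -- `hξ` is the soliton equation on `(ξ, ξ)`, with `c² (n + n - 2) = 2(n - 1)c²`. Bochner's formula
  -- `hb` replaces `Ric(ξ, ξ)`.
  linear_combination hξ - hb

/-- The pointwise identity behind the volume formula for the solitons
`(∇^{df}, Q^g, grad f, λ)`. -/
theorem soliton_oneFormConnection_identity {lam : ℝ} (hf : ContMDiff (𝓡 n) 𝓘(ℝ, ℝ) ∞ f)
    (hc : ∀ x, g.normSqGrad f x = c)
    (h : IsAlmostSoliton (g.oneFormConnection (mvfderiv (𝓡 n) f))
      (g.ricciOperator g.leviCivita) (g.grad f) (fun _ ↦ lam)) (x : M) :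
    (lam - 3 * c) * c = -g.normSqTensor x (g.hessian g.leviCivita f x)
      + mvfderiv (𝓡 n) (g.scal g.leviCivita) x (g.grad f x) := by
  have eqn := IsAlmostSoliton.hessian_add_ricci g h
  simp only [g.hessian_oneFormConnection hc] at eqn
  have hd := g.mvfderiv_scal_of_eq hf h.contMDiff (g.scal_of_soliton_oneFormConnection hc h)
    (g.grad f x)
  have hb := g.ricci_grad_grad hf hc x
  have hξ := congrArg (fun B ↦ B (g.grad f x) (g.grad f x)) (eqn x)
  simp only [add_apply, smul_apply, g.hessian_grad_grad hf hc, smul_eq_mul,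
    ContinuousLinearMap.smulRight_apply, g.inner_grad_eq_mul hc, g.inner_grad] at hξ
  rw [mvfderiv_const] at hd
  simp only [zero_apply] at hd
  rw [hd]
  -- Here `3c²` collects `2c²` from `2 df ⊗ df` and `c²` from `c g`. As `λ` is constant, `ξ(scal) =
  -- -ξ(Δf)`.
  linear_combination -hξ + hb

end Soliton

/-! ### Critical points, and finiteness of the volume measure. -/

section Integration

/-- A function on a nonempty compact manifold has a critical point, so that the square norm of its
gradient vanishes if it is constant. -/
theorem normSqGrad_const_eq_zero [CompactSpace M] [Nonempty M] {f : M → ℝ}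
    (hf : ContMDiff (𝓡 n) 𝓘(ℝ, ℝ) ∞ f) {c : ℝ} (hc : ∀ x, g.normSqGrad f x = c) : c = 0 := by
  obtain ⟨x, -, hx⟩ := isCompact_univ.exists_isMaxOn univ_nonempty hf.continuous.continuousOn
  have h0 : mfderiv (𝓡 n) 𝓘(ℝ, ℝ) f x = 0 := by
    have hmax : IsLocalMax (f ∘ (extChartAt (𝓡 n) x).symm) (extChartAt (𝓡 n) x x) := by
      refine Filter.Eventually.of_forall fun y ↦ ?_
      simpa using hx (mem_univ ((extChartAt (𝓡 n) x).symm y))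
    rw [((hf x).mdifferentiableAt (by simp)).mfderiv]
    have e : writtenInExtChartAt (𝓡 n) 𝓘(ℝ, ℝ) x f = f ∘ (extChartAt (𝓡 n) x).symm := by
      simp only [writtenInExtChartAt, extChartAt_model_space_eq_id]; rfl
    rw [e, (𝓡 n).range_eq_univ, fderivWithin_univ]
    exact hmax.fderiv_eq_zero
  -- At a maximum point `c = df(grad f) = 0`, whatever the signature.
  rw [← hc x, normSqGrad, inner_grad, mvfderiv, h0]
  simp

/-- Identifies the coordinate vectors in `chartGram` with the smooth frame, whence the continuity of
the Gram determinant. -/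
theorem mfderiv_chartAt_symm (p : M) {y : EuclideanSpace ℝ (Fin n)}
    (hy : y ∈ (chartAt (EuclideanSpace ℝ (Fin n)) p).target) (i : Fin n) :
    mfderiv 𝓘(ℝ, EuclideanSpace ℝ (Fin n)) (𝓡 n) (chartAt (EuclideanSpace ℝ (Fin n)) p).symm y
      (EuclideanSpace.single i (1 : ℝ) : EuclideanSpace ℝ (Fin n)) =
      frame p i ((chartAt (EuclideanSpace ℝ (Fin n)) p).symm y) := by
  have hs := (chartAt (EuclideanSpace ℝ (Fin n)) p).map_target hy
  rw [frame_eq p i hs, TangentBundle.symmL_trivializationAt hs, (𝓡 n).range_eq_univ,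
    mfderivWithin_univ]
  have key : ∀ z : EuclideanSpace ℝ (Fin n), z = y →
      (mfderiv 𝓘(ℝ, EuclideanSpace ℝ (Fin n)) (𝓡 n) (chartAt (EuclideanSpace ℝ (Fin n)) p).symm y
        (EuclideanSpace.single i (1 : ℝ) : EuclideanSpace ℝ (Fin n)) : EuclideanSpace ℝ (Fin n)) =
      mfderiv 𝓘(ℝ, EuclideanSpace ℝ (Fin n)) (𝓡 n) (chartAt (EuclideanSpace ℝ (Fin n)) p).symm z
        (EuclideanSpace.single i (1 : ℝ) : EuclideanSpace ℝ (Fin n)) := by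
    rintro _ rfl
    rfl
  exact key _ ((chartAt (EuclideanSpace ℝ (Fin n)) p).right_inv hy)

theorem continuousOn_det_chartGram (p : M) :
    ContinuousOn (fun y ↦ (g.chartGram (chartAt (EuclideanSpace ℝ (Fin n)) p) y).det)
      (chartAt (EuclideanSpace ℝ (Fin n)) p).target := by
  set e := chartAt (EuclideanSpace ℝ (Fin n)) p
  have h1 : ∀ i j, ContinuousOn (fun y ↦ g.chartGram e y i j) e.target := by
    intro i j
    have h2 : ContinuousOn (fun x ↦ g.inner x (frame p i x) (frame p j x)) e.source :=
      (g.smoothOn_inner (vsmoothOn_frame p i) (vsmoothOn_frame p j)).continuousOn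
    refine (h2.comp e.continuousOn_symm e.mapsTo_symm).congr fun y hy ↦ ?_
    simp only [chartGram, Matrix.of_apply, Function.comp]
    rw [mfderiv_chartAt_symm p hy, mfderiv_chartAt_symm p hy]
  exact continuousOn_iff_continuous_domRestrict.2 (Continuous.matrix_det
    (continuous_matrix fun i j ↦ continuousOn_iff_continuous_domRestrict.1 (h1 i j)))

/-- By compactness only finitely many partition functions are nonzero, and each density is bounded
and vanishes off the compact chart image of the support of its partition function. -/
instance isFiniteMeasure_volumeMeasure [T2Space M] [CompactSpace M] [MeasurableSpace M]
    [BorelSpace M] : IsFiniteMeasure g.volumeMeasure := by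
  let ρ : SmoothPartitionOfUnity M (𝓡 n) M univ :=
    (SmoothPartitionOfUnity.exists_isSubordinate_chartAt_source (𝓡 n) M).choose
  have hρ : ρ.IsSubordinate fun p ↦ (chartAt (EuclideanSpace ℝ (Fin n)) p).source :=
    (SmoothPartitionOfUnity.exists_isSubordinate_chartAt_source (𝓡 n) M).choose_spec
  let ν (p : M) : Measure M :=
    (((volume : Measure (EuclideanSpace ℝ (Fin n))).restrict
      (chartAt (EuclideanSpace ℝ (Fin n)) p).target).withDensity fun y ↦
      ENNReal.ofReal (ρ p ((chartAt (EuclideanSpace ℝ (Fin n)) p).symm y) *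
        √|(g.chartGram (chartAt (EuclideanSpace ℝ (Fin n)) p) y).det|)).map
      (chartAt (EuclideanSpace ℝ (Fin n)) p).symm
  have hν : g.volumeMeasure = Measure.sum ν := rfl
  have hfin : {p | (Function.support (ρ p)).Nonempty}.Finite :=
    ρ.locallyFinite.finite_nonempty_of_compact
  have hzero : ∀ p ∉ hfin.toFinset, ν p univ = 0 := by
    intro p hp
    have hp0 : ∀ x, ρ p x = 0 := by
      simpa [Function.support_nonempty_iff, funext_iff] using hp
    simp [ν, hp0]
  have hlt : ∀ p, ν p univ < ⊤ := by
    intro p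
    set e := chartAt (EuclideanSpace ℝ (Fin n)) p with he
    set K := e '' tsupport (ρ p)
    have hsub : tsupport (ρ p) ⊆ e.source := hρ p
    have hK : IsCompact K :=
      (isClosed_tsupport (ρ p)).isCompact.image_of_continuousOn (e.continuousOn.mono hsub)
    have hKt : K ⊆ e.target := by
      rintro _ ⟨x, hx, rfl⟩
      exact e.map_source (hsub hx)
    obtain ⟨C, hC⟩ := hK.exists_bound_of_continuousOn ((g.continuousOn_det_chartGram p).mono hKt)
    have hle : ν p univ ≤ ∫⁻ y in e.target, ENNReal.ofReal (ρ p (e.symm y) *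
        √|(g.chartGram e y).det|) := by
      -- An upper bound on the mass suffices, so measurability of `e.symm` need not be proved:
      -- `Measure.map` is zero by default when it fails.
      by_cases hm : AEMeasurable e.symm (((volume : Measure (EuclideanSpace ℝ (Fin n))).restrict
          e.target).withDensity fun y ↦ ENNReal.ofReal (ρ p (e.symm y) *
            √|(g.chartGram e y).det|))
      · simp only [ν]
        rw [Measure.map_apply_of_aemeasurable hm MeasurableSet.univ, preimage_univ,
          withDensity_apply _ MeasurableSet.univ, Measure.restrict_univ]
      · simp only [ν]
        rw [Measure.map_of_not_aemeasurable hm]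
        simp
    refine hle.trans_lt ?_
    calc ∫⁻ y in e.target, ENNReal.ofReal (ρ p (e.symm y) * √|(g.chartGram e y).det|)
        ≤ ∫⁻ y in e.target, K.indicator (fun _ ↦ ENNReal.ofReal (√C)) y := by
          refine setLIntegral_mono' e.open_target.measurableSet fun y hy ↦ ?_
          by_cases hyK : y ∈ K
          · rw [indicator_of_mem hyK]
            refine ENNReal.ofReal_le_ofReal ?_
            calc ρ p (e.symm y) * √|(g.chartGram e y).det| ≤ 1 * √C := by
                  gcongr
                  · exact ρ.le_one p _
                  · exact hC y hyK
              _ = √C := one_mul _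
          · have h0 : ρ p (e.symm y) = 0 := by
              by_contra hne
              exact hyK ⟨e.symm y, subset_tsupport _ hne, e.right_inv hy⟩
            simp [h0]
      _ ≤ ∫⁻ y, K.indicator (fun _ ↦ ENNReal.ofReal (√C)) y := setLIntegral_le_lintegral _ _
      _ = ENNReal.ofReal (√C) * volume K := lintegral_indicator_const hK.measurableSet _
      _ < ⊤ := ENNReal.mul_lt_top ENNReal.ofReal_lt_top hK.measure_lt_top
  refine ⟨?_⟩
  rw [hν, Measure.sum_apply _ MeasurableSet.univ, tsum_eq_sum hzero]
  exact ENNReal.sum_lt_top.2 fun p _ ↦ hlt p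

theorem integrable_of_contMDiff [T2Space M] [CompactSpace M] [MeasurableSpace M] [BorelSpace M]
    {a : M → ℝ} (ha : ContMDiff (𝓡 n) 𝓘(ℝ, ℝ) ∞ a) : Integrable a g.volumeMeasure :=
  ha.continuous.integrable_of_hasCompactSupport (HasCompactSupport.of_compactSpace a)

end Integration

end PseudoRiemannianMetric

end

/-! ### Integration of the pointwise identities. -/

theorem mainTheorem10 {n : ℕ} {M : Type*} [TopologicalSpace M]
    [ChartedSpace (EuclideanSpace ℝ (Fin n)) M] [IsManifold (𝓡 n) ∞ M]
    [T2Space M] [CompactSpace M] [MeasurableSpace M] [BorelSpace M]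
    (g : PseudoRiemannianMetric n M)
    (f : M → ℝ) (hf : ContMDiff (𝓡 n) 𝓘(ℝ, ℝ) ∞ f)
    (c : ℝ) (hc : ∀ x, g.normSqGrad f x = c) :
    -- gradient almost solitons `(∇^g, Q^{df}, grad f, λ)`
    (∀ lam : M → ℝ,
      PseudoRiemannianMetric.IsAlmostSoliton g.leviCivita
        (g.ricciOperator (g.oneFormConnection (mvfderiv (𝓡 n) f))) (g.grad f) lam →
      2 * ((n : ℝ) - 1) * c ^ 2 * g.volumeMeasure.real Set.univ =
          (∫ x, g.normSqTensor x (g.hessian g.leviCivita f x) ∂g.volumeMeasure)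
          + c * (∫ x, lam x ∂g.volumeMeasure)
          + n * (∫ x, mvfderiv (𝓡 n) lam x (g.grad f x) ∂g.volumeMeasure)
          - ∫ x, mvfderiv (𝓡 n) (g.scal g.leviCivita) x (g.grad f x) ∂g.volumeMeasure
      ∧ (2 ≤ n → c ≠ 0 →
        g.volumeMeasure.real Set.univ =
          1 / (2 * ((n : ℝ) - 1) * c ^ 2) *
            ((∫ x, g.normSqTensor x (g.hessian g.leviCivita f x) ∂g.volumeMeasure)
            + c * (∫ x, lam x ∂g.volumeMeasure)
            + n * (∫ x, mvfderiv (𝓡 n) lam x (g.grad f x) ∂g.volumeMeasure)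
            - ∫ x, mvfderiv (𝓡 n) (g.scal g.leviCivita) x (g.grad f x) ∂g.volumeMeasure)))
    ∧
    -- gradient solitons `(∇^{df}, Q^g, grad f, λ)`, with `λ` constant
    (∀ lam : ℝ,
      PseudoRiemannianMetric.IsAlmostSoliton (g.oneFormConnection (mvfderiv (𝓡 n) f))
        (g.ricciOperator g.leviCivita) (g.grad f) (fun _ ↦ lam) →
      (lam - 3 * c) * c * g.volumeMeasure.real Set.univ =
          -(∫ x, g.normSqTensor x (g.hessian g.leviCivita f x) ∂g.volumeMeasure)
          + ∫ x, mvfderiv (𝓡 n) (g.scal g.leviCivita) x (g.grad f x) ∂g.volumeMeasure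
      ∧ (c ≠ 0 → lam ≠ 3 * c →
        g.volumeMeasure.real Set.univ =
          1 / ((lam - 3 * c) * c) *
            (-(∫ x, g.normSqTensor x (g.hessian g.leviCivita f x) ∂g.volumeMeasure)
            + ∫ x, mvfderiv (𝓡 n) (g.scal g.leviCivita) x (g.grad f x) ∂g.volumeMeasure))) := by
  have hN := g.integrable_of_contMDiff (g.contMDiff_normSqTensor_hessian hf)
  have hD : ∀ {a : M → ℝ}, ContMDiff (𝓡 n) 𝓘(ℝ, ℝ) ∞ a →
      Integrable (fun x ↦ mvfderiv (𝓡 n) a x (g.grad f x)) g.volumeMeasure := fun ha ↦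
    g.integrable_of_contMDiff (contMDiffOn_univ.1 (PseudoRiemannianMetric.SmoothOn.mvfderiv
      ha.contMDiffOn (g.vsmoothOn_grad_of_contMDiff hf univ) isOpen_univ))
  have hlap := g.contMDiff_laplacian hf
  -- `f` has a critical point, which makes the integral of `c Δf` vanish
  have hdiv : c * ∫ x, g.laplacian f x ∂g.volumeMeasure = 0 := by
    rcases isEmpty_or_nonempty M with hM | hM
    · simp [Measure.eq_zero_of_isEmpty]
    · rw [g.normSqGrad_const_eq_zero hf hc, zero_mul]
  refine ⟨fun lam h ↦ ?_, fun lam h ↦ ?_⟩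
  · have hscal := g.contMDiff_scal_of_eq hf h.contMDiff (g.scal_of_almostSoliton_leviCivita hf hc h)
    have hint := integral_congr_ae (μ := g.volumeMeasure) (Filter.Eventually.of_forall
      (g.almostSoliton_leviCivita_identity hf hc h))
    have i1 := g.integrable_of_contMDiff h.contMDiff
    have i2 := g.integrable_of_contMDiff hlap
    have key : 2 * ((n : ℝ) - 1) * c ^ 2 * g.volumeMeasure.real Set.univ =
          (∫ x, g.normSqTensor x (g.hessian g.leviCivita f x) ∂g.volumeMeasure)
          + c * (∫ x, lam x ∂g.volumeMeasure)
          + n * (∫ x, mvfderiv (𝓡 n) lam x (g.grad f x) ∂g.volumeMeasure)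
          - ∫ x, mvfderiv (𝓡 n) (g.scal g.leviCivita) x (g.grad f x) ∂g.volumeMeasure := by
      have j1 : Integrable (fun x ↦ g.normSqTensor x (g.hessian g.leviCivita f x) + c * lam x)
          g.volumeMeasure := hN.add (i1.const_mul c)
      have j2 : Integrable (fun x ↦ g.normSqTensor x (g.hessian g.leviCivita f x) + c * lam x
          + n * mvfderiv (𝓡 n) lam x (g.grad f x)) g.volumeMeasure :=
        j1.add ((hD h.contMDiff).const_mul n)
      have j3 : Integrable (fun x ↦ g.normSqTensor x (g.hessian g.leviCivita f x) + c * lam x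
          + n * mvfderiv (𝓡 n) lam x (g.grad f x)
          - mvfderiv (𝓡 n) (g.scal g.leviCivita) x (g.grad f x)) g.volumeMeasure :=
        j2.sub (hD hscal)
      rw [integral_sub j3 (i2.const_mul c), integral_sub j2 (hD hscal),
        integral_add j1 ((hD h.contMDiff).const_mul n), integral_add hN (i1.const_mul c),
        integral_const, integral_const_mul, integral_const_mul, integral_const_mul, hdiv,
        smul_eq_mul, sub_zero] at hint
      rw [← hint, mul_comm]
    refine ⟨key, fun hn hc0 ↦ ?_⟩
    have hn1 : (n : ℝ) - 1 ≠ 0 := by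
      have : (2 : ℝ) ≤ n := by exact_mod_cast hn
      linarith
    rw [← key]
    field_simp
  · have hscal := g.contMDiff_scal_of_eq hf h.contMDiff (g.scal_of_soliton_oneFormConnection hc h)
    have hint := integral_congr_ae (μ := g.volumeMeasure) (Filter.Eventually.of_forall
      (g.soliton_oneFormConnection_identity hf hc h))
    have key : (lam - 3 * c) * c * g.volumeMeasure.real Set.univ =
          -(∫ x, g.normSqTensor x (g.hessian g.leviCivita f x) ∂g.volumeMeasure)
          + ∫ x, mvfderiv (𝓡 n) (g.scal g.leviCivita) x (g.grad f x) ∂g.volumeMeasure := by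
      have j : Integrable (fun x ↦ -g.normSqTensor x (g.hessian g.leviCivita f x))
          g.volumeMeasure := hN.neg
      rw [integral_add j (hD hscal), integral_neg, integral_const, smul_eq_mul] at hint
      rw [← hint, mul_comm]
    refine ⟨key, fun hc0 hl ↦ ?_⟩
    have hl' : lam - 3 * c ≠ 0 := sub_ne_zero.2 hl
    rw [← key]
    field_simp
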